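/- Let $(X_1,Y_1),(X_2,Y_2),\dots$ be independent with a common joint density $h$ on $\mathbb R^2$ and marginal densities $f$ (of $X_i$) and $g$ (of $Y_i$). *Statistics.* For the first $N$ observations let $(r_i,s_i)\in\{1,\dots,N\}^2$ be the marginal ranks. For a cell $C$ with observed count $o_C$ and expected count $e_C$ the cell score $t_C$ is either Pearson's, $(o_C-e_C)^2/e_C$, or the likelihood ratio score $o_C\log(o_C/e_C)$ (with score $0$ if $o_C=e_C=0$, and $0\log 0=0$), the same choice being made throughout; the score of a partition is $T^{\mathcal I}=\sum_C t_C$, summed over its $m\times m$ cells. ADP (all derived partitions): the $\binom{N-1}{m-1}^2$ partitions of the rank plane given by $m-1$ cuts on each axis chosen from $\{1.5,\dots,N-0.5\}$, with outer boundaries $0.5$ and $N+0.5$. For $C=[a,b]\times[c,d]$, $o_C$ is the number of observations whose ranks lie in $C$ and $e_C=(b-a)(d-c)/N$. DDP (data derived partitions): the $\binom{N}{m-1}$ partitions given by $m-1$ of the observations, whose ranks are the boundaries on the two axes, with outer boundaries $0$ and $N+1$. For $C=[a,b]\times[c,d]$, $o_C$ is the number of observations with ranks strictly inside $C$ and $e_C=(b-a-1)(d-c-1)/(N-m+1)$.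 Let $S^{ADP}_{m\times m}$ and $S^{DDP}_{m\times m}$ be the sums, and $M^{ADP}_{m\times m}$ and $M^{DDP}_{m\times m}$ the maxima, of $T^{\mathcal I}$ over the respective partitions. *Test.* For one of these four families, $p_m$ is the permutation $p$-value: the fraction of the $N!$ permutations $\pi$ of $\{1,\dots,N\}$ for which the statistic at $(1,\pi(1)),\dots,(N,\pi(N))$ is at least as large as the observed one. For $m_{\max}=m_{\max}(N)\ge 2$, the level-$\alpha$ test based on $\min_{m\in\{2,\dots,m_{\max}\}}p_m$ rejects independence if the fraction of the $N!$ permutations whose minimum $p$-value is at most the observed minimum $p$-value is at most $\alpha$. The test is consistent if, for every fixed $\alpha\in(0,1)$, its rejection probability tends to $1$ as $N\to\infty$. **Theorem.** Suppose that there is a point $(x_0,y_0)$ such that $h$ is continuous at $(x_0,y_0)$, $f$ is continuous at $x_0$, $g$ is continuous at $y_0$, and $h(x_0,y_0)\ne f(x_0)g(y_0)$. Then the permutation test based on $\min_{m\in\{2,\dots,m_{\max}\}}p_m$ is consistent in each of the following cases: 1. it is based on $S^{DDP}_{m\times m}$ or on $S^{ADP}_{m\times m}$, and $m_{\max}$ is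 finite (bounded in $N$) or $\lim_{N\to\infty}m_{\max}/N^{1/3}=0$; 2. it is based on $M^{DDP}_{m\times m}$ or on $M^{ADP}_{m\times m}$, and $m_{\max}$ is finite (bounded in $N$) or $\lim_{N\to\infty}m_{\max}/\sqrt N=0$. -/

import Mathlib

open MeasureTheory ProbabilityTheory Filter Topology

noncomputable section

namespace MinPTest

/-- The two scores of a cell with observed count `o` and expected count `e`. -/
inductive CellScore
  | pearson
  | likelihoodRatio

/-- The score of a cell: Pearson `(o - e)² / e` or likelihood ratio `o log (o / e)`. With Lean's
conventions `x / 0 = 0` and `0 * x = 0`, a cell with `o = e = 0` has score `0`, and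
`0 log 0 = 0`. -/
def CellScore.eval : CellScore → ℝ → ℝ → ℝ
  | .pearson, o, e => (o - e) ^ 2 / e
  | .likelihoodRatio, o, e => o * Real.log (o / e)

/-- The pairs `(a, b)`, `a < b`, of consecutive elements of a finite set of boundaries. -/
def consecutivePairs (B : Finset ℕ) : Finset (ℕ × ℕ) :=
  (B ×ˢ B).filter fun p => p.1 < p.2 ∧ ∀ c ∈ B, ¬ (p.1 < c ∧ c < p.2)

/-- The rank of `x i` among `x 0, …, x (N - 1)`, a number in `{1, …, N}`. -/
def rank {N : ℕ} (x : Fin N → ℝ) (i : Fin N) : ℕ :=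
  (Finset.univ.filter fun j => x j ≤ x i).card

/-! ### All derived partitions (ADP)

A cut `k ∈ {1, …, N - 1}` stands for the half-integer `k + 0.5`, so that the outer boundaries
`0.5` and `N + 0.5` are `0` and `N`. -/

/-- The partitions of the rank plane into `m × m` cells: `m - 1` cuts on each axis. -/
def adpPartitions (N m : ℕ) : Finset (Finset ℕ × Finset ℕ) :=
  (Finset.Icc 1 (N - 1)).powersetCard (m - 1) ×ˢ (Finset.Icc 1 (N - 1)).powersetCard (m - 1)

/-- The intervals between `0.5`, the cuts in `A`, and `N + 0.5`. -/
def adpIntervals (N : ℕ) (A : Finset ℕ) : Finset (ℕ × ℕ) :=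
  consecutivePairs (insert 0 (insert N A))

/-- The number of observations, with ranks `(r i, s i)`, in the cell with rank range
`[p.1 + 0.5, p.2 + 0.5] × [q.1 + 0.5, q.2 + 0.5]`. -/
def adpObserved {N : ℕ} (r s : Fin N → ℕ) (p q : ℕ × ℕ) : ℕ :=
  (Finset.univ.filter fun i => (p.1 < r i ∧ r i ≤ p.2) ∧ (q.1 < s i ∧ s i ≤ q.2)).card

/-- The expected count in that cell. -/
def adpExpected (N : ℕ) (p q : ℕ × ℕ) : ℝ :=
  ((p.2 : ℝ) - p.1) * ((q.2 : ℝ) - q.1) / N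

/-- The score of the partition `I`. -/
def adpScore (t : CellScore) {N : ℕ} (r s : Fin N → ℕ) (I : Finset ℕ × Finset ℕ) : ℝ :=
  ∑ p ∈ adpIntervals N I.1, ∑ q ∈ adpIntervals N I.2,
    t.eval (adpObserved r s p q) (adpExpected N p q)

/-- `S^ADP_{m × m}`. -/
def sumADP (t : CellScore) (m : ℕ) {N : ℕ} (r s : Fin N → ℕ) : ℝ :=
  ∑ I ∈ adpPartitions N m, adpScore t r s I

/-- `M^ADP_{m × m}`: the supremum is a maximum over a finite set, nonempty for `1 ≤ m ≤ N`. -/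
def maxADP (t : CellScore) (m : ℕ) {N : ℕ} (r s : Fin N → ℕ) : ℝ :=
  sSup (adpScore t r s '' (adpPartitions N m : Set (Finset ℕ × Finset ℕ)))

/-! ### Data derived partitions (DDP) -/

/-- The partitions into `m × m` cells based on `m - 1` of the `N` observations. -/
def ddpPartitions (N m : ℕ) : Finset (Finset (Fin N)) :=
  Finset.univ.powersetCard (m - 1)

/-- The intervals, on the axis with ranks `r`, between the ranks of the observations in `I`; the
outer boundaries are `0` and `N + 1`. -/
def ddpIntervals {N : ℕ} (r : Fin N → ℕ) (I : Finset (Fin N)) : Finset (ℕ × ℕ) :=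
  consecutivePairs (insert 0 (insert (N + 1) (I.image r)))

/-- The number of observations strictly inside the cell with boundaries `p` and `q`. -/
def ddpObserved {N : ℕ} (r s : Fin N → ℕ) (p q : ℕ × ℕ) : ℕ :=
  (Finset.univ.filter fun i => (p.1 < r i ∧ r i < p.2) ∧ (q.1 < s i ∧ s i < q.2)).card

/-- The expected count strictly inside that cell, when `k` observations define the partition. -/
def ddpExpected (N k : ℕ) (p q : ℕ × ℕ) : ℝ :=
  ((p.2 : ℝ) - p.1 - 1) * ((q.2 : ℝ) - q.1 - 1) / ((N : ℝ) - k)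

/-- The score of the partition `I`. -/
def ddpScore (t : CellScore) {N : ℕ} (r s : Fin N → ℕ) (I : Finset (Fin N)) : ℝ :=
  ∑ p ∈ ddpIntervals r I, ∑ q ∈ ddpIntervals s I,
    t.eval (ddpObserved r s p q) (ddpExpected N I.card p q)

/-- `S^DDP_{m × m}`. -/
def sumDDP (t : CellScore) (m : ℕ) {N : ℕ} (r s : Fin N → ℕ) : ℝ :=
  ∑ I ∈ ddpPartitions N m, ddpScore t r s I

/-- `M^DDP_{m × m}`: the supremum is a maximum over a finite set, nonempty for `m ≤ N + 1`. -/
def maxDDP (t : CellScore) (m : ℕ) {N : ℕ} (r s : Fin N → ℕ) : ℝ :=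
  sSup (ddpScore t r s '' (ddpPartitions N m : Set (Finset (Fin N))))

/-! ### The permutation test based on the minimum p-value -/

/-- The ranks `1, …, N` in their natural order. -/
def natRank {N : ℕ} (i : Fin N) : ℕ := (i : ℕ) + 1

/-- The permutation p-value of a statistic `T` at the ranks `(r, s)`: the fraction of the `N!`
permutations `π` of `{1, …, N}` such that `T` at the pairs `(1, π 1), …, (N, π N)` is at least as
large as observed. -/
def pValue {N : ℕ} (T : (Fin N → ℕ) → (Fin N → ℕ) → ℝ) (r s : Fin N → ℕ) : ℝ :=
  ((Finset.univ.filter fun π : Equiv.Perm (Fin N) =>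
      T r s ≤ T natRank (fun i => natRank (π i))).card : ℝ) / (Nat.factorial N : ℝ)

/-- `min_{m ∈ {2, …, M}} p_m`, where `p_m` is the permutation p-value of the statistic `T m`. -/
def minPValue {N : ℕ} (T : ℕ → (Fin N → ℕ) → (Fin N → ℕ) → ℝ) (M : ℕ) (r s : Fin N → ℕ) : ℝ :=
  sInf ((fun m => pValue (T m) r s) '' Set.Icc 2 M)

/-- The p-value of the test that uses `min_{m ∈ {2, …, M}} p_m` as test statistic: the fraction of
the permutations for which the minimum p-value is at most the one observed. -/
def minPTestPValue {N : ℕ} (T : ℕ → (Fin N → ℕ) → (Fin N → ℕ) → ℝ) (M : ℕ) (r s : Fin N → ℕ) : ℝ :=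
  ((Finset.univ.filter fun π : Equiv.Perm (Fin N) =>
      minPValue T M natRank (fun i => natRank (π i)) ≤ minPValue T M r s).card : ℝ) /
    (Nat.factorial N : ℝ)

/-- The level `α` test rejects independence for the sample `(x i, y i)`, `i < N`. -/
def Rejects {N : ℕ} (T : ℕ → (Fin N → ℕ) → (Fin N → ℕ) → ℝ) (M : ℕ) (α : ℝ)
    (x y : Fin N → ℝ) : Prop :=
  minPTestPValue T M (rank x) (rank y) ≤ α

/-- Consistency of the tests based on `min_{m ∈ {2, …, mmax N}} p_m` for the sampling sequence
`(X i, Y i)`: at every level `α ∈ (0, 1)`, the probability that the test rejects on the basis of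
the first `N` observations tends to `1`. -/
def Consistent {Ω : Type*} [MeasurableSpace Ω] (P : Measure Ω) (X Y : ℕ → Ω → ℝ)
    (T : ℕ → ∀ {N : ℕ}, (Fin N → ℕ) → (Fin N → ℕ) → ℝ) (mmax : ℕ → ℕ) : Prop :=
  ∀ α : ℝ, 0 < α → α < 1 →
    Tendsto (fun N : ℕ => P {ω | Rejects (N := N) (fun m => T m) (mmax N) α
      (fun i => X i ω) (fun i => Y i ω)}) atTop (𝓝 1)

end MinPTest

end

/-! Only the table size m = 2 matters. Permutation p-values are superuniform, so a union bound over
the at most M values of m bounds the p-value of the combined test by M times p_2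
(`minPTestPValue_le`). It then suffices that almost surely p_2 = O(N^(-1/2)); this handles every M =
o(√N), for all four families, and the N^(1/3) condition enters only because it implies the √N one.

Observed side. Suppose the joint distribution function were the product of the marginal ones at
almost every point for the law of the data. Differentiating in each variable gives h = f g almost
everywhere on {h > 0}, hence h ≤ f g, hence h = f g almost everywhere because both integrate to 1;
this contradicts continuity at (x₀, y₀). So the two distribution functions differ at some point of
the support, and by monotonicity and continuity they stay apart on a small box of positive mass
(`exists_box_of_cdfGap_ne_zero`). By the law of large numbers a fixed proportion of the 2 × 2
partitions is cut inside this box, and each of these scores at least a constant times N.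

Permutation side. A 2 × 2 score of order N forces some corner of the rank square, with sides a and
b, to hold at least ab/N + c√(ab) points (`IsTable.exists_large_dev`). For a fixed corner
Chebyshev's inequality bounds the probability by O(1/N). Counts are monotone in the corner, so it is
enough to test O(√N) corners, with sides on a grid of fourth powers; the union has probability
O(N^(-1/2)) (`card_largeCorner_le`). -/

namespace MinPTest

/-! ### Scores of a `2 × 2` table -/

/-- From `log x ≤ x - 1`. The linear term `o - e` sums to zero over a table, so in total the
likelihood ratio score is dominated by Pearson's. -/
theorem CellScore.likelihoodRatio_le {o e : ℝ} (ho : 0 ≤ o) (he : 0 ≤ e) (h0 : e = 0 → o = 0) :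
    CellScore.likelihoodRatio.eval o e ≤ CellScore.pearson.eval o e + (o - e) := by
  simp only [CellScore.eval]
  rcases he.eq_or_lt with rfl | he
  · simp [h0 rfl]
  rcases ho.eq_or_lt with rfl | ho
  · have : (0 - e) ^ 2 / e = e := by field_simp; ring
    rw [this]; simp
  have h1 : Real.log (o / e) ≤ o / e - 1 := Real.log_le_sub_one_of_pos (by positivity)
  have h2 : o * Real.log (o / e) ≤ o * (o / e - 1) := by gcongr
  have h3 : o * (o / e - 1) = (o - e) ^ 2 / e + (o - e) := by field_simp; ring
  linarith

/-- Factor `o - e` through square roots and use (√o + √e)² ≤ 2(o + e) ≤ 4n. -/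
theorem sq_sub_div_le_sq_sqrt_sub {o e n : ℝ} (ho : 0 ≤ o) (he : 0 ≤ e) (hn : 0 < n)
    (hon : o ≤ n) (hen : e ≤ n) :
    (o - e) ^ 2 / (4 * n) ≤ (√o - √e) ^ 2 := by
  rw [div_le_iff₀ (by positivity)]
  have h1 := Real.sq_sqrt ho
  have h2 := Real.sq_sqrt he
  have h3 : (o - e) ^ 2 = (√o - √e) ^ 2 * (√o + √e) ^ 2 := by
    nth_rewrite 1 [← h1, ← h2]; ring
  rw [h3]
  gcongr
  nlinarith [sq_nonneg (√o - √e)]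

theorem CellScore.le_pearson {o e n : ℝ} (he : 0 ≤ e) (hn : 0 < n)
    (hen : e ≤ n) (h0 : e = 0 → o = 0) :
    (o - e) ^ 2 / (4 * n) ≤ CellScore.pearson.eval o e := by
  simp only [CellScore.eval]
  rcases he.eq_or_lt with rfl | he
  · simp [h0 rfl]
  gcongr
  linarith

/-- A Hellinger bound: log(o/e) = -2 log √(e/o) and `log x ≤ x - 1` give o log(o/e) ≥ (√o - √e)² +
(o - e). The linear term again disappears on summation. -/
theorem CellScore.le_likelihoodRatio {o e n : ℝ} (ho : 0 ≤ o) (he : 0 ≤ e) (hn : 0 < n)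
    (hon : o ≤ n) (hen : e ≤ n) (h0 : e = 0 → o = 0) :
    (o - e) ^ 2 / (4 * n) + (o - e) ≤ CellScore.likelihoodRatio.eval o e := by
  have h := sq_sub_div_le_sq_sqrt_sub ho he hn hon hen
  simp only [CellScore.eval]
  rcases he.eq_or_lt with rfl | he
  · simp [h0 rfl]
  rcases ho.eq_or_lt with rfl | ho
  · simp only [Real.sqrt_zero, zero_sub, neg_sq, Real.sq_sqrt he.le] at h
    simp only [zero_mul]
    rw [zero_sub, neg_sq]; linarith
  have h1 := Real.sq_sqrt ho.le
  have h2 := Real.sq_sqrt he.le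
  have h3 : 0 < √o := by positivity
  have h4 : 0 < √e := by positivity
  have h5 : Real.log (o / e) = -2 * Real.log (√e / √o) := by
    rw [Real.log_div ho.ne' he.ne', Real.log_div h4.ne' h3.ne', Real.log_sqrt he.le,
      Real.log_sqrt ho.le]; ring
  have h6 : Real.log (√e / √o) ≤ √e / √o - 1 := Real.log_le_sub_one_of_pos (by positivity)
  have h7 : o * (√e / √o) = √o * √e := by
    nth_rewrite 1 [← h1]; field_simp
  have h8 : o * Real.log (√e / √o) ≤ o * (√e / √o - 1) := by gcongr
  rw [h5]
  nlinarith

/-- A `2 × 2` table of counts `o` with row sums `a`, column sums `b` and total `n`. -/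
structure IsTable (o : Bool → Bool → ℝ) (a b : Bool → ℝ) (n : ℝ) : Prop where
  nonneg : ∀ i j, 0 ≤ o i j
  row : ∀ i, o i false + o i true = a i
  col : ∀ j, o false j + o true j = b j
  total : a false + a true = n
  pos : 0 < n

namespace IsTable

variable {o : Bool → Bool → ℝ} {a b : Bool → ℝ} {n : ℝ}

theorem le_row (h : IsTable o a b n) (i j : Bool) : o i j ≤ a i := by
  have h1 := h.row i
  have h2 := h.nonneg i false
  have h3 := h.nonneg i true
  cases j <;> linarith

theorem le_col (h : IsTable o a b n) (i j : Bool) : o i j ≤ b j := by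
  have h1 := h.col j
  have h2 := h.nonneg false j
  have h3 := h.nonneg true j
  cases i <;> linarith

theorem row_nonneg (h : IsTable o a b n) (i : Bool) : 0 ≤ a i :=
  (h.nonneg i true).trans (h.le_row i true)

theorem col_nonneg (h : IsTable o a b n) (j : Bool) : 0 ≤ b j :=
  (h.nonneg true j).trans (h.le_col true j)

theorem total_col (h : IsTable o a b n) : b false + b true = n := by
  linarith [h.row false, h.row true, h.col false, h.col true, h.total]

theorem row_le (h : IsTable o a b n) (i : Bool) : a i ≤ n := by
  have h1 := h.row_nonneg false
  have h2 := h.row_nonneg true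
  have h3 := h.total
  cases i <;> linarith

theorem col_le (h : IsTable o a b n) (i : Bool) : b i ≤ n := by
  have h1 := h.col_nonneg false
  have h2 := h.col_nonneg true
  have h3 := h.total_col
  cases i <;> linarith

theorem expected_nonneg (h : IsTable o a b n) (i j : Bool) : 0 ≤ a i * b j / n :=
  div_nonneg (mul_nonneg (h.row_nonneg i) (h.col_nonneg j)) h.pos.le

theorem expected_le (h : IsTable o a b n) (i j : Bool) : a i * b j / n ≤ n := by
  rw [div_le_iff₀ h.pos]
  exact mul_le_mul (h.row_le i) (h.col_le j) (h.col_nonneg j) h.pos.le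

theorem eq_zero (h : IsTable o a b n) (i j : Bool) (h0 : a i * b j / n = 0) : o i j = 0 := by
  have h1 := h.nonneg i j
  have h2 := h.le_row i j
  have h3 := h.le_col i j
  rcases div_eq_zero_iff.1 h0 with h0 | h0
  · rcases mul_eq_zero.1 h0 with h0 | h0 <;> linarith
  · exact absurd h0 h.pos.ne'

theorem sum_sub (h : IsTable o a b n) : ∑ i, ∑ j, (o i j - a i * b j / n) = 0 := by
  simp only [Fintype.sum_bool]
  have h1 : a true * b true / n + a true * b false / n + (a false * b true / n +
      a false * b false / n) = n := by
    have : a true * b true / n + a true * b false / n + (a false * b true / n +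
      a false * b false / n) = (a false + a true) * (b false + b true) / n := by ring
    rw [this, h.total, h.total_col, mul_self_div_self]
  linarith [h.row false, h.row true, h.total]

/-- Observed and expected counts have the same column sums, so the two deviations in a column
cancel. This trades a deficit for an excess. -/
theorem dev_not_row (h : IsTable o a b n) (i j : Bool) :
    o (!i) j - a (!i) * b j / n = -(o i j - a i * b j / n) := by
  have h1 := h.col j
  have h2 : a i * b j / n + a (!i) * b j / n = b j := by
    have h3 : a i + a (!i) = n := by have := h.total; cases i <;> simp <;> linarith
    rw [← add_div, ← add_mul, h3, mul_div_cancel_left₀ _ h.pos.ne']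
  cases i <;> simp only [Bool.not_false, Bool.not_true] at * <;> linarith

theorem score_le_pearson (h : IsTable o a b n) (t : CellScore) :
    ∑ i, ∑ j, t.eval (o i j) (a i * b j / n) ≤
      ∑ i, ∑ j, CellScore.pearson.eval (o i j) (a i * b j / n) := by
  cases t with
  | pearson => exact le_rfl
  | likelihoodRatio =>
    rw [← add_zero (∑ i, ∑ j, CellScore.pearson.eval (o i j) (a i * b j / n)), ← h.sum_sub]
    simp only [← Finset.sum_add_distrib]
    exact Finset.sum_le_sum fun i _ => Finset.sum_le_sum fun j _ =>
      CellScore.likelihoodRatio_le (h.nonneg i j) (h.expected_nonneg i j) (h.eq_zero i j)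

theorem sum_sq_le_score (h : IsTable o a b n) (t : CellScore) :
    ∑ i, ∑ j, (o i j - a i * b j / n) ^ 2 / (4 * n) ≤
      ∑ i, ∑ j, t.eval (o i j) (a i * b j / n) := by
  cases t with
  | pearson =>
    exact Finset.sum_le_sum fun i _ => Finset.sum_le_sum fun j _ =>
      CellScore.le_pearson (h.expected_nonneg i j) h.pos (h.expected_le i j) (h.eq_zero i j)
  | likelihoodRatio =>
    rw [← add_zero (∑ i, ∑ j, (o i j - a i * b j / n) ^ 2 / (4 * n)), ← h.sum_sub]
    simp only [← Finset.sum_add_distrib]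
    exact Finset.sum_le_sum fun i _ => Finset.sum_le_sum fun j _ =>
      CellScore.le_likelihoodRatio (h.nonneg i j) (h.expected_nonneg i j) h.pos
        ((h.le_row i j).trans (h.row_le i)) (h.expected_le i j) (h.eq_zero i j)

theorem sq_le_score (h : IsTable o a b n) (t : CellScore) (i j : Bool) :
    (o i j - a i * b j / n) ^ 2 / (4 * n) ≤ ∑ i, ∑ j, t.eval (o i j) (a i * b j / n) := by
  have hn := h.pos
  refine le_trans ?_ (h.sum_sq_le_score t)
  exact (Finset.single_le_sum (f := fun j => (o i j - a i * b j / n) ^ 2 / (4 * n))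
    (fun j _ => by positivity) (Finset.mem_univ j)).trans
    (Finset.single_le_sum (f := fun i => ∑ j, (o i j - a i * b j / n) ^ 2 / (4 * n))
    (fun i _ => Finset.sum_nonneg fun j _ => by positivity) (Finset.mem_univ i))

theorem score_nonneg (h : IsTable o a b n) (t : CellScore) :
    0 ≤ ∑ i, ∑ j, t.eval (o i j) (a i * b j / n) := by
  have hn := h.pos
  exact le_trans (by positivity) (h.sq_le_score t true true)

/-- A score of the order of the sample size comes with a cell that has a large positive
deviation. -/
theorem exists_large_dev (h : IsTable o a b n) (t : CellScore) {c : ℝ} (hc : 0 < c) (hc1 : c ≤ 1)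
    (hT : 4 * c ^ 2 * n ≤ ∑ i, ∑ j, t.eval (o i j) (a i * b j / n)) :
    ∃ i j, 0 < a i ∧ 0 < b j ∧ a i * b j / n + c ^ 2 * √(a i * b j) ≤ o i j := by
  have hn := h.pos
  -- One of the four cells carries at least a quarter of the Pearson total.
  obtain ⟨i, j, hij⟩ : ∃ i j, c ^ 2 * n ≤ CellScore.pearson.eval (o i j) (a i * b j / n) := by
    by_contra! H
    have h1 := hT.trans (h.score_le_pearson t)
    simp only [Fintype.sum_bool] at h1
    linarith [H true true, H true false, H false true, H false false]
  simp only [CellScore.eval] at hij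
  have ha := h.row_nonneg i
  have hb := h.col_nonneg j
  have hab : 0 < a i * b j := by
    refine lt_of_le_of_ne (mul_nonneg ha hb) fun h0 => ?_
    rw [← h0] at hij
    simp only [zero_div, div_zero] at hij
    have : 0 < c ^ 2 * n := by positivity
    linarith
  have ha' : 0 < a i := lt_of_le_of_ne ha fun h0 => by rw [← h0] at hab; simp at hab
  have hb' : 0 < b j := lt_of_le_of_ne hb fun h0 => by rw [← h0] at hab; simp at hab
  have hd : (c * √(a i * b j)) ^ 2 ≤ (o i j - a i * b j / n) ^ 2 := by
    rw [le_div_iff₀ (by positivity)] at hij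
    rw [mul_pow, Real.sq_sqrt hab.le]
    calc _ = c ^ 2 * n * (a i * b j / n) := by field_simp
      _ ≤ _ := hij
  have hd' := sq_le_sq.1 hd
  rw [abs_of_nonneg (by positivity)] at hd'
  set s := √(a i * b j) with hs
  have hs0 : 0 < s := Real.sqrt_pos.2 hab
  have hs2 : s ^ 2 = a i * b j := Real.sq_sqrt hab.le
  rcases le_abs.1 hd' with hd | hd
  · refine ⟨i, j, ha', hb', ?_⟩
    have : c ^ 2 * s ≤ c * s := by
      gcongr
      nlinarith
    linarith
  -- The deviation is now a deficit, which cannot exceed the expected count s²/n; hence s ≥ c n. The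
  -- other cell of the column then has an excess of at least c s ≥ c² n, enough because its own
  -- square root is at most n.
  have hsn : c * n ≤ s := by
    have h1 : c * s ≤ s ^ 2 / n := by
      rw [hs2]
      linarith [h.nonneg i j]
    rw [le_div_iff₀ hn] at h1
    nlinarith
  have hdn : c ^ 2 * n ≤ o (!i) j - a (!i) * b j / n := by
    rw [h.dev_not_row]
    nlinarith
  have hpos : 0 < c ^ 2 * n := by positivity
  have ha2 : 0 < a (!i) := by
    refine lt_of_le_of_ne (h.row_nonneg _) fun h0 => ?_
    have h1 := h.le_row (!i) j
    rw [← h0] at h1 hdn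
    simp only [zero_mul, zero_div] at hdn
    linarith
  refine ⟨!i, j, ha2, hb', ?_⟩
  have h2 : √(a (!i) * b j) ≤ n := by
    rw [Real.sqrt_le_left hn.le, sq]
    exact mul_le_mul (h.row_le _) (h.col_le _) hb hn.le
  have h3 : c ^ 2 * √(a (!i) * b j) ≤ c ^ 2 * n := by gcongr
  linarith

end IsTable

end MinPTest

/-! ### Counts under a uniformly random permutation -/

/-- The number of elements of `A` that `π` maps into `B`. -/
def Equiv.Perm.count {ι : Type*} [DecidableEq ι] (π : Equiv.Perm ι) (A B : Finset ι) : ℕ := (A.filter fun i => π i ∈ B).card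

open Equiv in
theorem Equiv.Perm.count_mono {ι : Type*} [DecidableEq ι] (π : Perm ι) {A A' B B' : Finset ι} (hA : A ⊆ A') (hB : B ⊆ B') :
    π.count A B ≤ π.count A' B' :=
  Finset.card_le_card fun i hi => by
    simp only [Finset.mem_filter] at hi ⊢
    exact ⟨hA hi.1, hB hi.2⟩

section Permutation

variable {ι : Type*} [Fintype ι] [DecidableEq ι]

open Equiv in
theorem Equiv.Perm.sum_comp_eq_of_perm (F : Perm ι → ℝ) (σ : Perm ι) :
    ∑ π : Perm ι, F (π * σ) = ∑ π : Perm ι, F π :=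
  Equiv.sum_comp (Equiv.mulRight σ) F

open Equiv in
/-- The second moment of a linear permutation statistic. -/
theorem Equiv.Perm.sum_sq_linear (x y : ι → ℝ) (hx : ∑ i, x i = 0) (hy : ∑ i, y i = 0) :
    ((Fintype.card ι : ℝ) - 1) * ∑ π : Perm ι, (∑ i, x i * y (π i)) ^ 2 =
      (Fintype.card ι).factorial * ((∑ i, x i ^ 2) * ∑ i, y i ^ 2) := by
  set N : ℝ := (Fintype.card ι : ℝ) with hN
  set C : ι → ι → ℝ := fun i j => ∑ π : Perm ι, y (π i) * y (π j) with hC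
  -- Invariance under relabelling leaves `C` one value on the diagonal and one off it; the vanishing
  -- row sums express the second through the first.
  have hinv : ∀ (σ : Perm ι) i j, C (σ i) (σ j) = C i j := fun σ i j =>
    sum_comp_eq_of_perm (fun π => y (π i) * y (π j)) σ
  have hdiag : ∀ i j, C i i = C j j := fun i j => by
    have := hinv (swap j i) j j
    rwa [swap_apply_left] at this
  have hoff : ∀ i j k, j ≠ i → k ≠ i → C i j = C i k := fun i j k hj hk => by
    have := hinv (swap k j) i k
    rwa [swap_apply_left, swap_apply_of_ne_of_ne hk.symm hj.symm] at this
  have hrow : ∀ i, ∑ j, C i j = 0 := fun i => by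
    simp only [hC]
    rw [Finset.sum_comm]
    refine Finset.sum_eq_zero fun π _ => ?_
    rw [← Finset.mul_sum, Equiv.sum_comp π y, hy, mul_zero]
  have hoff' : ∀ i j, j ≠ i → (N - 1) * C i j = -C i i := fun i j hj => by
    have h1 := hrow i
    rw [← Finset.add_sum_erase _ _ (Finset.mem_univ i),
      Finset.sum_congr rfl (fun k hk => hoff i k j (Finset.ne_of_mem_erase hk) hj),
      Finset.sum_const, Finset.card_erase_of_mem (Finset.mem_univ i), Finset.card_univ,
      nsmul_eq_mul, Nat.cast_pred (Fintype.card_pos_iff.2 ⟨i⟩)] at h1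
    linarith
  have htr : ∑ i, C i i = (Fintype.card ι).factorial * ∑ i, y i ^ 2 := by
    simp only [hC]
    rw [Finset.sum_comm]
    have : ∀ π : Perm ι, ∑ i, y (π i) * y (π i) = ∑ i, y i ^ 2 := fun π => by
      rw [← Equiv.sum_comp π (fun i => y i ^ 2)]
      simp only [sq]
    rw [Finset.sum_congr rfl fun π _ => this π, Finset.sum_const, Finset.card_univ,
      Fintype.card_perm, nsmul_eq_mul]
  have hdiag' : ∀ i, N * C i i = (Fintype.card ι).factorial * ∑ i, y i ^ 2 := fun i => by
    rw [← htr, Finset.sum_congr rfl fun j _ => hdiag j i, Finset.sum_const, Finset.card_univ,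
      nsmul_eq_mul]
  have hsq : ∑ π : Perm ι, (∑ i, x i * y (π i)) ^ 2 = ∑ i, ∑ j, x i * x j * C i j := by
    have h1 : ∀ π : Perm ι, (∑ i, x i * y (π i)) ^ 2 =
        ∑ i, ∑ j, x i * x j * (y (π i) * y (π j)) := fun π => by
      rw [sq, Finset.sum_mul_sum]
      exact Finset.sum_congr rfl fun i _ => Finset.sum_congr rfl fun j _ => by ring
    rw [Finset.sum_congr rfl fun π _ => h1 π, Finset.sum_comm]
    refine Finset.sum_congr rfl fun i _ => ?_
    rw [Finset.sum_comm]
    exact Finset.sum_congr rfl fun j _ => (Finset.mul_sum _ _ _).symm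
  have hC' : ∀ i j, (N - 1) * C i j = (if j = i then N * C i i else 0) - C i i := fun i j => by
    split_ifs with h
    · rw [h]; ring
    · rw [hoff' i j h]; ring
  rw [hsq, Finset.mul_sum, Finset.sum_mul, Finset.mul_sum]
  refine Finset.sum_congr rfl fun i _ => ?_
  rw [Finset.mul_sum]
  have : ∀ j, (N - 1) * (x i * x j * C i j) =
      (if j = i then x i * x j * (N * C i i) else 0) - x j * (x i * C i i) := fun j => by
    have := hC' i j
    split_ifs at this ⊢ <;> linear_combination (x i * x j) * this
  rw [Finset.sum_congr rfl fun j _ => this j, Finset.sum_sub_distrib, ← Finset.sum_mul, hx,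
    Finset.sum_ite_eq' Finset.univ i, if_pos (Finset.mem_univ i), hdiag' i]
  ring

theorem sum_indicator_sub_mean [Nonempty ι] (A : Finset ι) :
    ∑ i, ((if i ∈ A then (1 : ℝ) else 0) - A.card / Fintype.card ι) = 0 := by
  rw [Finset.sum_sub_distrib, Finset.sum_ite_mem]
  simp
  field_simp
  ring

theorem sum_sq_indicator_sub_mean_le [Nonempty ι] (A : Finset ι) :
    ∑ i, ((if i ∈ A then (1 : ℝ) else 0) - A.card / Fintype.card ι) ^ 2 ≤ A.card := by
  have h1 : ∀ i, ((if i ∈ A then (1 : ℝ) else 0) - A.card / Fintype.card ι) ^ 2 =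
      (if i ∈ A then (1 : ℝ) else 0) - (A.card / Fintype.card ι : ℝ) ^ 2 -
        2 * (A.card / Fintype.card ι : ℝ) *
          ((if i ∈ A then (1 : ℝ) else 0) - A.card / Fintype.card ι) := by
    intro i; split_ifs <;> ring
  rw [Finset.sum_congr rfl fun i _ => h1 i, Finset.sum_sub_distrib, ← Finset.mul_sum,
    sum_indicator_sub_mean, Finset.sum_sub_distrib, Finset.sum_ite_mem]
  simp
  positivity

open Equiv in
-- Centring both indicators puts the deviation of the count into the form required by
-- `sum_sq_linear`.
theorem Equiv.Perm.count_sub_mean [Nonempty ι] (π : Perm ι) (A B : Finset ι) :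
    ∑ i, ((if i ∈ A then (1 : ℝ) else 0) - A.card / Fintype.card ι) *
      ((if π i ∈ B then (1 : ℝ) else 0) - B.card / Fintype.card ι) =
      π.count A B - A.card * B.card / Fintype.card ι := by
  have h1 : ∀ i, ((if i ∈ A then (1 : ℝ) else 0) - A.card / Fintype.card ι) *
      ((if π i ∈ B then (1 : ℝ) else 0) - B.card / Fintype.card ι) =
      (if i ∈ A.filter (fun i => π i ∈ B) then (1 : ℝ) else 0) -
        (if i ∈ A then (1 : ℝ) else 0) * (B.card / Fintype.card ι) -
      (A.card / Fintype.card ι) * ((if π i ∈ B then (1 : ℝ) else 0) - B.card / Fintype.card ι) := by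
    intro i
    by_cases h1 : i ∈ A <;> by_cases h2 : π i ∈ B <;> simp [h1, h2] <;> ring
  rw [Finset.sum_congr rfl fun i _ => h1 i, Finset.sum_sub_distrib, ← Finset.mul_sum,
    Equiv.sum_comp π (fun i => (if i ∈ B then (1 : ℝ) else 0) - B.card / Fintype.card ι),
    sum_indicator_sub_mean, Finset.sum_sub_distrib, Finset.sum_ite_mem, ← Finset.sum_mul,
    Finset.sum_ite_mem]
  simp [Equiv.Perm.count]
  ring

open Equiv in
/-- Chebyshev's inequality for the counts. -/
theorem Equiv.Perm.card_large_count_le [Nonempty ι] (A B : Finset ι) (hA : A.Nonempty)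
    (hB : B.Nonempty) {κ : ℝ} (hκ : 0 < κ) :
    κ ^ 2 * ((Fintype.card ι : ℝ) - 1) * ((Finset.univ.filter fun π : Perm ι =>
      (A.card * B.card / Fintype.card ι : ℝ) + κ * √(A.card * B.card : ℝ) ≤ π.count A B).card : ℝ)
      ≤ (Fintype.card ι).factorial := by
  have hN : (0 : ℝ) ≤ (Fintype.card ι : ℝ) - 1 := by
    have : 1 ≤ Fintype.card ι := Fintype.card_pos
    rw [sub_nonneg]; exact_mod_cast this
  have hAB : (0 : ℝ) < A.card * B.card := by
    have := hA.card_pos; have := hB.card_pos; positivity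
  set S := Finset.univ.filter fun π : Perm ι =>
    (A.card * B.card / Fintype.card ι : ℝ) + κ * √(A.card * B.card : ℝ) ≤ π.count A B with hS
  have h1 := sum_sq_linear _ _ (sum_indicator_sub_mean A) (sum_indicator_sub_mean B)
  simp only [count_sub_mean] at h1
  have h2 : (S.card : ℝ) * (κ ^ 2 * (A.card * B.card)) ≤
      ∑ π : Perm ι, ((π.count A B : ℝ) - A.card * B.card / Fintype.card ι) ^ 2 := by
    rw [← nsmul_eq_mul]
    refine (Finset.card_nsmul_le_sum S
      (fun π => ((π.count A B : ℝ) - A.card * B.card / Fintype.card ι) ^ 2) _ fun π hπ => ?_).trans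
      (Finset.sum_le_univ_sum_of_nonneg fun π => sq_nonneg _)
    have h3 : κ * √(A.card * B.card : ℝ) ≤ π.count A B - A.card * B.card / Fintype.card ι := by
      have := (Finset.mem_filter.1 hπ).2
      linarith
    calc _ = (κ * √(A.card * B.card : ℝ)) ^ 2 := by rw [mul_pow, Real.sq_sqrt hAB.le]
      _ ≤ _ := by gcongr
  have h4 := mul_le_mul_of_nonneg_left h2 hN
  rw [h1] at h4
  have h5 : (∑ i, ((if i ∈ A then (1 : ℝ) else 0) - A.card / Fintype.card ι) ^ 2) *
      (∑ i, ((if i ∈ B then (1 : ℝ) else 0) - B.card / Fintype.card ι) ^ 2) ≤ A.card * B.card :=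
    mul_le_mul (sum_sq_indicator_sub_mean_le A) (sum_sq_indicator_sub_mean_le B)
      (Finset.sum_nonneg fun i _ => sq_nonneg _) (by positivity)
  have h6 := h4.trans (mul_le_mul_of_nonneg_left h5 (Nat.cast_nonneg _))
  refine le_of_mul_le_mul_right ?_ hAB
  linarith

end Permutation

/-! ### Corners of the rank square and the grid of fourth powers. -/

namespace MinPTest

/-- The first (`e = false`) or the last (`e = true`) `a` of the indices `0, …, N - 1`. -/
def segment (N : ℕ) (e : Bool) (a : ℕ) : Finset (Fin N) :=
  Finset.univ.filter fun i => if e then N ≤ (i : ℕ) + a else (i : ℕ) < a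

theorem mem_segment_false {N a : ℕ} {i : Fin N} : i ∈ segment N false a ↔ (i : ℕ) < a := by
  simp [segment]

theorem mem_segment_true {N a : ℕ} {i : Fin N} : i ∈ segment N true a ↔ N ≤ (i : ℕ) + a := by
  simp [segment]

theorem card_segment {N : ℕ} (e : Bool) {a : ℕ} (ha : a ≤ N) : (segment N e a).card = a := by
  cases e with
  | false => simp [segment, Fin.card_filter_val_lt, ha]
  | true =>
    have : segment N true a = (segment N false (N - a))ᶜ := by
      ext i
      simp only [Finset.mem_compl, mem_segment_false, mem_segment_true]
      omega
    rw [this, Finset.card_compl]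
    simp [segment, Fin.card_filter_val_lt]
    omega

theorem segment_mono {N : ℕ} (e : Bool) {a a' : ℕ} (h : a ≤ a') :
    segment N e a ⊆ segment N e a' := by
  intro i
  cases e
  · simp only [mem_segment_false]; omega
  · simp only [mem_segment_true]; omega

/-- The permutation `π` puts many more points than expected into some corner of the square. -/
def LargeCorner {N : ℕ} (c : ℝ) (π : Equiv.Perm (Fin N)) : Prop :=
  ∃ e e' : Bool, ∃ a b : ℕ, (1 ≤ a ∧ a ≤ N) ∧ (1 ≤ b ∧ b ≤ N) ∧
    (a * b / N : ℝ) + c * √(a * b : ℝ) ≤ π.count (segment N e a) (segment N e' b)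

theorem exists_fourth_power_grid {a N K : ℕ} (ha : 1 ≤ a) (haN : a ≤ N) (hK : N ≤ K ^ 4) :
    ∃ k ∈ Finset.Icc 1 K, a ≤ k ^ 4 ∧ (k - 1) ^ 4 < a := by
  have hex : ∃ k, a ≤ k ^ 4 := ⟨K, haN.trans hK⟩
  have h1 := Nat.find_spec hex
  have h0 : 1 ≤ Nat.find hex := by
    rcases Nat.eq_zero_or_pos (Nat.find hex) with h | h
    · rw [h] at h1; simp at h1; omega
    · exact h
  refine ⟨Nat.find hex, Finset.mem_Icc.2 ⟨h0, Nat.find_min' hex (haN.trans hK)⟩, h1, ?_⟩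
  exact not_le.1 (Nat.find_min hex (by omega))

/-- Rounding a = s⁴ up to the next fourth power k⁴ costs at most 4k³ ≤ 32s³, a relative error of
order 1/s. -/
theorem fourth_power_grid_bounds {a k : ℕ} {s : ℝ} (hs : 0 ≤ s) (hsa : s ^ 4 = a) (hk : 1 ≤ k)
    (ha : 1 ≤ a) (hka : (k - 1) ^ 4 < a) :
    (k : ℝ) ≤ 2 * s ∧ (k : ℝ) ^ 4 ≤ 16 * s ^ 4 ∧ (k : ℝ) ^ 4 ≤ s ^ 4 + 32 * s ^ 3 := by
  have h1 : ((k : ℝ) - 1) ^ 4 < s ^ 4 := by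
    rw [hsa, ← Nat.cast_pred hk]; exact_mod_cast hka
  have hk' : (1 : ℝ) ≤ k := by exact_mod_cast hk
  have hks : (k : ℝ) - 1 < s := lt_of_pow_lt_pow_left₀ 4 hs h1
  have hs1 : 1 ≤ s := by
    by_contra! h
    have := pow_lt_one₀ hs h (n := 4) (by norm_num)
    rw [hsa] at this
    have : (1 : ℝ) ≤ a := by exact_mod_cast ha
    linarith
  have h2 : (k : ℝ) ≤ 2 * s := by
    linarith
  have h3 : (k : ℝ) ^ 3 ≤ 8 * s ^ 3 := by
    calc (k : ℝ) ^ 3 ≤ (2 * s) ^ 3 := by gcongr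
      _ = _ := by ring
  refine ⟨h2, ?_, ?_⟩
  · calc (k : ℝ) ^ 4 ≤ (2 * s) ^ 4 := by gcongr
      _ = _ := by ring
  · have h4 : (k : ℝ) ^ 4 ≤ (k - 1) ^ 4 + 4 * k ^ 3 := by nlinarith [sq_nonneg ((k : ℝ) - 1)]
    linarith

/-- Enlarging a corner can only raise its count. Rounding both sides up to fourth powers, capped at
N, raises the expected count by at most 544 √(ab) / N^(1/4), where 544 = 32 + 32 · 16; by `hNc` this
uses at most half of the excess c√(ab). The square root grows at most by the factor 16, so an excess
with constant c/32 fits into the other half. -/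
theorem exists_grid_count {N : ℕ} {c : ℝ} (hc : 0 < c) (hNc : 1088 ≤ c * √(√N)) {K : ℕ}
    (hK : N ≤ K ^ 4) {π : Equiv.Perm (Fin N)} (hπ : LargeCorner c π) :
    ∃ q ∈ (Finset.univ : Finset (Bool × Bool)) ×ˢ (Finset.Icc 1 K ×ˢ Finset.Icc 1 K),
      (((min (q.2.1 ^ 4) N : ℕ) : ℝ) * (min (q.2.2 ^ 4) N : ℕ) / N) +
        (c / 32) * √(((min (q.2.1 ^ 4) N : ℕ) : ℝ) * (min (q.2.2 ^ 4) N : ℕ)) ≤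
      π.count (segment N q.1.1 (min (q.2.1 ^ 4) N)) (segment N q.1.2 (min (q.2.2 ^ 4) N)) := by
  obtain ⟨e, e', a, b, ⟨ha, haN⟩, ⟨hb, hbN⟩, hab⟩ := hπ
  obtain ⟨k, hk, hka, hka'⟩ := exists_fourth_power_grid ha haN hK
  obtain ⟨l, hl, hlb, hlb'⟩ := exists_fourth_power_grid hb hbN hK
  refine ⟨((e, e'), (k, l)), by simp only [Finset.mem_product, Finset.mem_univ, hk, hl, and_self],
    ?_⟩
  simp only
  obtain ⟨s, hs, hsa⟩ : ∃ s : ℝ, 0 ≤ s ∧ s ^ 4 = a := ⟨√(√a), by positivity, by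
    rw [show (4 : ℕ) = 2 * 2 from rfl, pow_mul, Real.sq_sqrt (by positivity),
      Real.sq_sqrt (by positivity)]⟩
  obtain ⟨t, ht, htb⟩ : ∃ s : ℝ, 0 ≤ s ∧ s ^ 4 = b := ⟨√(√b), by positivity, by
    rw [show (4 : ℕ) = 2 * 2 from rfl, pow_mul, Real.sq_sqrt (by positivity),
      Real.sq_sqrt (by positivity)]⟩
  set n := √(√(N : ℝ)) with hn
  have hnN : n ^ 4 = N := by
    rw [show (4 : ℕ) = 2 * 2 from rfl, pow_mul, Real.sq_sqrt (by positivity),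
      Real.sq_sqrt (by positivity)]
  have hn0 : 0 < n := by
    rcases (Real.sqrt_nonneg (√(N : ℝ))).eq_or_lt with h | h
    · rw [hn, ← h] at hNc; norm_num at hNc
    · exact h
  have hsn : s ≤ n := le_of_pow_le_pow_left₀ (n := 4) (by norm_num) hn0.le (by
    rw [hsa, hnN]; exact_mod_cast haN)
  have htn : t ≤ n := le_of_pow_le_pow_left₀ (n := 4) (by norm_num) hn0.le (by
    rw [htb, hnN]; exact_mod_cast hbN)
  obtain ⟨-, hk1, hk2⟩ := fourth_power_grid_bounds hs hsa (Finset.mem_Icc.1 hk).1 ha hka'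
  obtain ⟨-, hl1, hl2⟩ := fourth_power_grid_bounds ht htb (Finset.mem_Icc.1 hl).1 hb hlb'
  set A := min (k ^ 4) N with hA
  set B := min (l ^ 4) N with hB
  have hAk : (A : ℝ) ≤ (k : ℝ) ^ 4 := by exact_mod_cast min_le_left _ _
  have hBl : (B : ℝ) ≤ (l : ℝ) ^ 4 := by exact_mod_cast min_le_left _ _
  have hcount : (π.count (segment N e a) (segment N e' b) : ℝ) ≤
      π.count (segment N e A) (segment N e' B) := by
    exact_mod_cast π.count_mono (segment_mono e (le_min hka haN)) (segment_mono e' (le_min hlb hbN))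
  refine le_trans ?_ (hab.trans hcount)
  have hsq : √(a * b : ℝ) = s ^ 2 * t ^ 2 := by
    rw [← hsa, ← htb, show s ^ 4 * t ^ 4 = (s ^ 2 * t ^ 2) ^ 2 by ring,
      Real.sqrt_sq (by positivity)]
  have hsq' : √(A * B : ℝ) ≤ 16 * (s ^ 2 * t ^ 2) := by
    rw [Real.sqrt_le_left (by positivity)]
    calc (A * B : ℝ) ≤ (16 * s ^ 4) * (16 * t ^ 4) := by
          gcongr
          · exact hAk.trans hk1
          · exact hBl.trans hl1
      _ = _ := by ring
  have hprod : (A * B : ℝ) ≤ s ^ 4 * t ^ 4 + 544 * (s ^ 2 * t ^ 2) * n ^ 3 := by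
    have h1 : (A * B : ℝ) ≤ s ^ 4 * t ^ 4 + s ^ 4 * (32 * t ^ 3) + 32 * s ^ 3 * (16 * t ^ 4) :=
      calc (A * B : ℝ) ≤ (s ^ 4 + 32 * s ^ 3) * B := by
            gcongr; exact hAk.trans hk2
        _ = s ^ 4 * B + 32 * s ^ 3 * B := by ring
        _ ≤ s ^ 4 * (t ^ 4 + 32 * t ^ 3) + 32 * s ^ 3 * (16 * t ^ 4) := by
            gcongr
            · exact hBl.trans hl2
            · exact hBl.trans hl1
        _ = _ := by ring
    have h2 : s ^ 2 * t ≤ n ^ 3 :=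
      calc s ^ 2 * t ≤ n ^ 2 * n := by gcongr
        _ = _ := by ring
    have h3 : s * t ^ 2 ≤ n ^ 3 :=
      calc s * t ^ 2 ≤ n * n ^ 2 := by gcongr
        _ = _ := by ring
    have h4 : s ^ 2 * t ^ 2 * (s ^ 2 * t) ≤ s ^ 2 * t ^ 2 * n ^ 3 := by gcongr
    have h5 : s ^ 2 * t ^ 2 * (s * t ^ 2) ≤ s ^ 2 * t ^ 2 * n ^ 3 := by gcongr
    linarith
  have hdiv : (A * B / N : ℝ) ≤ (a * b / N : ℝ) + c / 2 * (s ^ 2 * t ^ 2) := by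
    rw [← hsa, ← htb, ← hnN, div_le_iff₀ (by positivity), add_mul,
      div_mul_cancel₀ _ (by positivity)]
    refine hprod.trans ?_
    have h1 : 1088 * (s ^ 2 * t ^ 2 * n ^ 3) ≤ c * n * (s ^ 2 * t ^ 2 * n ^ 3) := by gcongr
    linarith
  rw [hsq]
  have h1 : c / 32 * √(A * B : ℝ) ≤ c / 32 * (16 * (s ^ 2 * t ^ 2)) := by gcongr
  linarith

open Classical in
-- There are K ≤ 2N^(1/4) grid sides, hence 4K² ≤ 16√N corners, each of probability at most
-- 1024/(c²(N - 1)) by Chebyshev with κ = c/32. A geometric grid would be smaller, but its constant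
-- relative error would swamp the excess.
theorem card_largeCorner_le {N : ℕ} (hN : 2 ≤ N) {c : ℝ} (hc : 0 < c) (hNc : 1088 ≤ c * √(√N)) :
    ((Finset.univ.filter fun π : Equiv.Perm (Fin N) => LargeCorner c π).card : ℝ) ≤
      16384 / c ^ 2 * (√N / (N - 1)) * N.factorial := by
  have : Nonempty (Fin N) := ⟨⟨0, by omega⟩⟩
  have hN1 : (0 : ℝ) < N - 1 := by
    have : (2 : ℝ) ≤ N := by exact_mod_cast hN
    linarith
  obtain ⟨K, hK, hKN, hKN'⟩ := exists_fourth_power_grid (a := N) (N := N) (K := N) (by omega) le_rfl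
    (Nat.le_self_pow (by norm_num) N)
  have hK2 : (K : ℝ) ^ 2 ≤ 4 * √N := by
    have h1 := (fourth_power_grid_bounds (s := √(√(N : ℝ))) (by positivity) (by
      rw [show (4 : ℕ) = 2 * 2 from rfl, pow_mul, Real.sq_sqrt (by positivity),
      Real.sq_sqrt (by positivity)]) (Finset.mem_Icc.1 hK).1 (by omega : 1 ≤ N) hKN').1
    calc (K : ℝ) ^ 2 ≤ (2 * √(√(N : ℝ))) ^ 2 := by gcongr
      _ = _ := by rw [mul_pow, Real.sq_sqrt (by positivity)]; norm_num
  set I := (Finset.univ : Finset (Bool × Bool)) ×ˢ (Finset.Icc 1 K ×ˢ Finset.Icc 1 K) with hI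
  set S : (Bool × Bool) × (ℕ × ℕ) → Finset (Equiv.Perm (Fin N)) := fun q =>
    Finset.univ.filter fun π =>
      (((min (q.2.1 ^ 4) N : ℕ) : ℝ) * (min (q.2.2 ^ 4) N : ℕ) / N) +
        (c / 32) * √(((min (q.2.1 ^ 4) N : ℕ) : ℝ) * (min (q.2.2 ^ 4) N : ℕ)) ≤
      π.count (segment N q.1.1 (min (q.2.1 ^ 4) N)) (segment N q.1.2 (min (q.2.2 ^ 4) N)) with hS
  have hsub : (Finset.univ.filter fun π : Equiv.Perm (Fin N) => LargeCorner c π) ⊆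
      I.biUnion S := by
    intro π hπ
    obtain ⟨q, hq, h⟩ := exists_grid_count hc hNc hKN (Finset.mem_filter.1 hπ).2
    exact Finset.mem_biUnion.2 ⟨q, hq, Finset.mem_filter.2 ⟨Finset.mem_univ _, h⟩⟩
  have hSq : ∀ q ∈ I, ((S q).card : ℝ) ≤ N.factorial * (1024 / (c ^ 2 * (N - 1))) := by
    intro q hq
    simp only [hI, Finset.mem_product, Finset.mem_Icc] at hq
    have hA := card_segment (N := N) q.1.1 (min_le_right (q.2.1 ^ 4) N)
    have hB := card_segment (N := N) q.1.2 (min_le_right (q.2.2 ^ 4) N)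
    have hA0 : (segment N q.1.1 (min (q.2.1 ^ 4) N)).Nonempty := by
      rw [← Finset.card_pos, hA]
      exact lt_min (pow_pos (by omega) 4) (by omega)
    have hB0 : (segment N q.1.2 (min (q.2.2 ^ 4) N)).Nonempty := by
      rw [← Finset.card_pos, hB]
      exact lt_min (pow_pos (by omega) 4) (by omega)
    have h1 := Equiv.Perm.card_large_count_le _ _ hA0 hB0 (κ := c / 32) (by positivity)
    rw [hA, hB, Fintype.card_fin] at h1
    rw [mul_div_assoc', le_div_iff₀ (by positivity)]
    refine le_trans (le_of_eq ?_) (mul_le_mul_of_nonneg_right h1 (by norm_num : (0 : ℝ) ≤ 1024))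
    ring
  calc ((Finset.univ.filter fun π : Equiv.Perm (Fin N) => LargeCorner c π).card : ℝ)
      ≤ ((I.biUnion S).card : ℝ) := by exact_mod_cast Finset.card_le_card hsub
    _ ≤ ∑ q ∈ I, ((S q).card : ℝ) := by exact_mod_cast Finset.card_biUnion_le
    _ ≤ I.card * (N.factorial * (1024 / (c ^ 2 * (N - 1)))) := by
        rw [← nsmul_eq_mul]; exact Finset.sum_le_card_nsmul _ _ _ hSq
    _ = 4 * (K : ℝ) ^ 2 * (N.factorial * (1024 / (c ^ 2 * (N - 1)))) := by
        simp [hI]; left; ring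
    _ ≤ 4 * (4 * √N) * (N.factorial * (1024 / (c ^ 2 * (N - 1)))) := by gcongr
    _ = _ := by field_simp; norm_num

end MinPTest

namespace MinPTest

/-! ### The statistics for `m = 2` -/

theorem consecutivePairs_triple {u v w : ℕ} (huv : u < v) (hvw : v < w) :
    consecutivePairs (insert u (insert w {v})) = {(u, v), (v, w)} := by
  ext ⟨p, q⟩
  simp only [consecutivePairs, Finset.mem_filter, Finset.mem_product, Finset.mem_insert,
    Finset.mem_singleton, forall_eq_or_imp, forall_eq, Prod.mk.injEq]
  omega

theorem sum_consecutivePairs_triple {u v w : ℕ} (huv : u < v) (hvw : v < w) (F : ℕ × ℕ → ℝ) :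
    ∑ p ∈ consecutivePairs (insert u (insert w {v})), F p =
      ∑ e : Bool, F (bif e then (v, w) else (u, v)) := by
  rw [consecutivePairs_triple huv hvw, Finset.sum_pair (by simp; omega), Fintype.sum_bool, add_comm]
  rfl

/-- `r` lists `1, …, N` in some order. -/
structure IsRanking {N : ℕ} (r : Fin N → ℕ) : Prop where
  injective : Function.Injective r
  mem : ∀ i, r i ∈ Finset.Icc 1 N

namespace IsRanking

variable {N : ℕ} {r s : Fin N → ℕ}

/-- By pigeonhole an injective map into N values attains each of them exactly once. -/
theorem card_filter_mem (hr : IsRanking r) {S : Finset ℕ} (hS : S ⊆ Finset.Icc 1 N) :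
    (Finset.univ.filter fun i => r i ∈ S).card = S.card := by
  rw [← Finset.card_image_of_injective _ hr.injective]
  congr 1
  have himg : Finset.univ.image r = Finset.Icc 1 N := by
    refine Finset.eq_of_subset_of_card_le (fun k hk => ?_) ?_
    · obtain ⟨i, -, rfl⟩ := Finset.mem_image.1 hk
      exact hr.mem i
    · rw [Finset.card_image_of_injective _ hr.injective]; simp
  ext k
  simp only [Finset.mem_image, Finset.mem_filter, Finset.mem_univ, true_and]
  constructor
  · rintro ⟨i, hi, rfl⟩; exact hi
  · intro hk
    have h1 := hS hk
    rw [← himg] at h1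
    obtain ⟨i, -, rfl⟩ := Finset.mem_image.1 h1
    exact ⟨i, hk, rfl⟩

theorem natRank : IsRanking (natRank : Fin N → ℕ) where
  injective i j h := by simp only [MinPTest.natRank] at h; omega
  mem i := by simp only [MinPTest.natRank, Finset.mem_Icc]; omega

theorem natRank_perm (π : Equiv.Perm (Fin N)) : IsRanking fun i => MinPTest.natRank (π i) where
  injective := natRank.injective.comp π.injective
  mem i := natRank.mem (π i)

theorem one_le (hr : IsRanking r) (i : Fin N) : 1 ≤ r i := (Finset.mem_Icc.1 (hr.mem i)).1

theorem le (hr : IsRanking r) (i : Fin N) : r i ≤ N := (Finset.mem_Icc.1 (hr.mem i)).2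

end IsRanking

theorem card_filter_split {N : ℕ} (p q q' : Fin N → Prop) [DecidablePred p] [DecidablePred q]
    [DecidablePred q'] (h : ∀ i, p i → (q' i ↔ ¬ q i)) :
    (Finset.univ.filter fun i => p i ∧ q i).card + (Finset.univ.filter fun i => p i ∧ q' i).card =
      (Finset.univ.filter p).card := by
  rw [← Finset.card_filter_add_card_filter_not (s := Finset.univ.filter p) q, Finset.filter_filter,
    Finset.filter_filter]
  congr 2
  ext i
  simp only [Finset.mem_filter, Finset.mem_univ, true_and]
  exact ⟨fun hi => ⟨hi.1, (h i hi.1).1 hi.2⟩, fun hi => ⟨hi.1, (h i hi.1).2 hi.2⟩⟩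

/-- The two intervals of an axis that is cut at `v`. -/
def halfAxis (v w : ℕ) (e : Bool) : ℕ × ℕ := bif e then (v, w) else (0, v)

/-! ### 2 × 2 tables from all derived partitions. -/

section ADP

variable {N : ℕ} {r s : Fin N → ℕ} {a b : ℕ}

theorem adpScore_singleton (t : CellScore) (ha : a ∈ Finset.Icc 1 (N - 1))
    (hb : b ∈ Finset.Icc 1 (N - 1)) :
    adpScore t r s ({a}, {b}) = ∑ e : Bool, ∑ e' : Bool,
      t.eval (adpObserved r s (halfAxis a N e) (halfAxis b N e'))
        ((bif e then (N : ℝ) - a else a) * (bif e' then (N : ℝ) - b else b) / N) := by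
  rw [Finset.mem_Icc] at ha hb
  simp only [adpScore, adpIntervals]
  rw [sum_consecutivePairs_triple (by omega) (by omega)]
  refine Finset.sum_congr rfl fun e _ => ?_
  rw [sum_consecutivePairs_triple (by omega) (by omega)]
  refine Finset.sum_congr rfl fun e' _ => ?_
  cases e <;> cases e' <;> simp [adpExpected, halfAxis]

/-- The margins are deterministic, since each axis carries every rank from 1 to N once. -/
theorem adp_isTable (hr : IsRanking r) (hs : IsRanking s) (ha : a ∈ Finset.Icc 1 (N - 1))
    (hb : b ∈ Finset.Icc 1 (N - 1)) :
    IsTable (fun e e' => (adpObserved r s (halfAxis a N e) (halfAxis b N e') : ℝ))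
      (fun e => bif e then (N : ℝ) - a else a) (fun e => bif e then (N : ℝ) - b else b) N := by
  rw [Finset.mem_Icc] at ha hb
  have hside : ∀ (r : Fin N → ℕ), IsRanking r → ∀ v, 1 ≤ v ∧ v ≤ N - 1 → ∀ e,
      (((Finset.univ.filter fun i => (halfAxis v N e).1 < r i ∧ r i ≤ (halfAxis v N e).2).card : ℕ) :
        ℝ) = bif e then (N : ℝ) - v else v := by
    intro r hr v hv e
    have h1 := hr.card_filter_mem (S := Finset.Ioc (halfAxis v N e).1 (halfAxis v N e).2) (by
      intro k
      cases e <;> simp only [halfAxis, Finset.mem_Ioc, Finset.mem_Icc, cond_true, cond_false] <;>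
        omega)
    simp only [Finset.mem_Ioc, Nat.card_Ioc] at h1
    rw [h1]
    cases e
    · simp [halfAxis]
    · simp only [halfAxis, cond_true]; rw [Nat.cast_sub (by omega)]
  refine ⟨fun e e' => Nat.cast_nonneg _, fun e => ?_, fun e' => ?_, ?_, ?_⟩
  · rw [← hside r hr a ha e, ← Nat.cast_add]
    congr 1
    refine card_filter_split _ _ _ fun i _ => ?_
    have := hs.one_le i; have := hs.le i
    simp only [halfAxis, cond_true, cond_false]; omega
  · rw [← hside s hs b hb e', ← Nat.cast_add]
    congr 1
    simp only [adpObserved, and_comm (b := (halfAxis b N e').1 < s _ ∧ _)]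
    refine card_filter_split _ _ _ fun i _ => ?_
    have := hr.one_le i; have := hr.le i
    simp only [halfAxis, cond_true, cond_false]; omega
  · simp
  · exact_mod_cast (by omega : 0 < N)

theorem adpObserved_eq_count (π : Equiv.Perm (Fin N)) (e e' : Bool) :
    adpObserved natRank (fun i => natRank (π i)) (halfAxis a N e) (halfAxis b N e') =
      π.count (segment N e (bif e then N - a else a))
        (segment N e' (bif e' then N - b else b)) := by
  rw [adpObserved, Equiv.Perm.count]
  congr 1
  ext i
  have h1 := i.isLt
  have h2 := (π i).isLt
  rw [Finset.mem_filter, Finset.mem_filter]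
  cases e <;> cases e' <;>
  simp only [halfAxis, cond_true, cond_false, Finset.mem_univ, true_and,
    mem_segment_false, mem_segment_true, natRank] <;> omega

theorem largeCorner_of_adpScore (t : CellScore) (π : Equiv.Perm (Fin N))
    (ha : a ∈ Finset.Icc 1 (N - 1)) (hb : b ∈ Finset.Icc 1 (N - 1)) {c : ℝ} (hc : 0 < c)
    (hc1 : c ≤ 1) (hT : 4 * c ^ 2 * N ≤ adpScore t natRank (fun i => natRank (π i)) ({a}, {b})) :
    LargeCorner (c ^ 2) π := by
  rw [adpScore_singleton t ha hb] at hT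
  obtain ⟨e, e', h1, h2, h3⟩ := (adp_isTable .natRank (.natRank_perm π) ha hb).exists_large_dev t
    hc hc1 hT
  rw [adpObserved_eq_count π] at h3
  rw [Finset.mem_Icc] at ha hb
  refine ⟨e, e', _, _, ?_, ?_, h3.trans' (le_of_eq ?_)⟩
  · cases e <;> simp only [cond_true, cond_false] <;> omega
  · cases e' <;> simp only [cond_true, cond_false] <;> omega
  · have h4 : ∀ v, 1 ≤ v ∧ v ≤ N - 1 → ∀ e : Bool, ((bif e then N - v else v : ℕ) : ℝ) =
        bif e then (N : ℝ) - v else v := by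
      intro v hv e
      cases e
      · rfl
      · simp only [cond_true]; rw [Nat.cast_sub (by omega)]
    rw [h4 a ha, h4 b hb]

theorem adpScore_nonneg (t : CellScore) (hr : IsRanking r) (hs : IsRanking s)
    (ha : a ∈ Finset.Icc 1 (N - 1)) (hb : b ∈ Finset.Icc 1 (N - 1)) :
    0 ≤ adpScore t r s ({a}, {b}) := by
  rw [adpScore_singleton t ha hb]
  exact (adp_isTable hr hs ha hb).score_nonneg t

theorem le_adpScore (t : CellScore) (hr : IsRanking r) (hs : IsRanking s)
    (ha : a ∈ Finset.Icc 1 (N - 1)) (hb : b ∈ Finset.Icc 1 (N - 1)) :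
    ((adpObserved r s (0, a) (0, b) : ℝ) - a * b / N) ^ 2 / (4 * N) ≤
      adpScore t r s ({a}, {b}) := by
  rw [adpScore_singleton t ha hb]
  exact (adp_isTable hr hs ha hb).sq_le_score t false false

theorem mem_adpPartitions_two {I : Finset ℕ × Finset ℕ} :
    I ∈ adpPartitions N 2 ↔
      ∃ a ∈ Finset.Icc 1 (N - 1), ∃ b ∈ Finset.Icc 1 (N - 1), I = ({a}, {b}) := by
  simp only [adpPartitions, Finset.mem_product, Finset.mem_powersetCard, Nat.add_one_sub_one,
    Finset.card_eq_one]
  constructor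
  · rintro ⟨⟨h1, a, h2⟩, h3, b, h4⟩
    rw [h2, Finset.singleton_subset_iff] at h1
    rw [h4, Finset.singleton_subset_iff] at h3
    exact ⟨a, h1, b, h3, Prod.ext h2 h4⟩
  · rintro ⟨a, ha, b, hb, rfl⟩
    exact ⟨⟨Finset.singleton_subset_iff.2 ha, a, rfl⟩, Finset.singleton_subset_iff.2 hb, b, rfl⟩

theorem card_adpPartitions_two : (adpPartitions N 2).card = (N - 1) * (N - 1) := by
  simp [adpPartitions]

end ADP

/-! ### 2 × 2 tables from data derived partitions. -/

section DDP

variable {N : ℕ} {r s : Fin N → ℕ} {i : Fin N}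

theorem ddpScore_singleton (t : CellScore) (hr : IsRanking r) (hs : IsRanking s) :
    ddpScore t r s {i} = ∑ e : Bool, ∑ e' : Bool,
      t.eval (ddpObserved r s (halfAxis (r i) (N + 1) e) (halfAxis (s i) (N + 1) e'))
        ((bif e then (N : ℝ) - r i else r i - 1) * (bif e' then (N : ℝ) - s i else s i - 1) /
          (N - 1)) := by
  have hr1 := hr.one_le i; have hr2 := hr.le i
  have hs1 := hs.one_le i; have hs2 := hs.le i
  simp only [ddpScore, ddpIntervals, Finset.image_singleton]
  rw [sum_consecutivePairs_triple (by omega) (by omega)]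
  refine Finset.sum_congr rfl fun e _ => ?_
  rw [sum_consecutivePairs_triple (by omega) (by omega)]
  refine Finset.sum_congr rfl fun e' _ => ?_
  cases e <;> cases e' <;> simp [ddpExpected, halfAxis] <;> ring_nf

/-- The defining observation `i` lies on the boundary and in no cell, hence the total `N - 1`. No
other observation shares a rank with it, so all the others lie strictly inside cells. -/
theorem ddp_isTable (hr : IsRanking r) (hs : IsRanking s) (hN : 2 ≤ N) :
    IsTable (fun e e' => (ddpObserved r s (halfAxis (r i) (N + 1) e)
        (halfAxis (s i) (N + 1) e') : ℝ))
      (fun e => bif e then (N : ℝ) - r i else r i - 1)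
      (fun e => bif e then (N : ℝ) - s i else s i - 1) (N - 1) := by
  have hside : ∀ (r : Fin N → ℕ), IsRanking r → ∀ e,
      (((Finset.univ.filter fun j => (halfAxis (r i) (N + 1) e).1 < r j ∧
        r j < (halfAxis (r i) (N + 1) e).2).card : ℕ) : ℝ) =
          bif e then (N : ℝ) - r i else r i - 1 := by
    intro r hr e
    have hr1 := hr.one_le i; have hr2 := hr.le i
    have h1 := hr.card_filter_mem
      (S := Finset.Ioo (halfAxis (r i) (N + 1) e).1 (halfAxis (r i) (N + 1) e).2) (by
        intro k
        cases e <;> simp only [halfAxis, Finset.mem_Ioo, Finset.mem_Icc, cond_true, cond_false] <;>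
          omega)
    simp only [Finset.mem_Ioo, Nat.card_Ioo] at h1
    rw [h1]
    cases e
    · simp only [halfAxis, cond_false, Nat.sub_zero]; rw [Nat.cast_sub (by omega), Nat.cast_one]
    · simp only [halfAxis, cond_true]
      rw [show N + 1 - r i - 1 = N - r i by omega, Nat.cast_sub (by omega)]
  refine ⟨fun e e' => Nat.cast_nonneg _, fun e => ?_, fun e' => ?_, ?_, ?_⟩
  · rw [← hside r hr e, ← Nat.cast_add]
    congr 1
    refine card_filter_split _ _ _ fun j hj => ?_
    have h1 := hs.one_le j; have h2 := hs.le j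
    have h3 : s j ≠ s i := fun h => by
      rw [hs.injective h] at hj
      cases e <;> simp [halfAxis] at hj
    simp only [halfAxis, cond_true, cond_false]; omega
  · rw [← hside s hs e', ← Nat.cast_add]
    congr 1
    simp only [ddpObserved, and_comm (b := (halfAxis (s i) (N + 1) e').1 < s _ ∧ _)]
    refine card_filter_split _ _ _ fun j hj => ?_
    have h1 := hr.one_le j; have h2 := hr.le j
    have h3 : r j ≠ r i := fun h => by
      rw [hr.injective h] at hj
      cases e' <;> simp [halfAxis] at hj
    simp only [halfAxis, cond_true, cond_false]; omega
  · simp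
  · have : (2 : ℝ) ≤ N := by exact_mod_cast hN
    linarith

theorem ddpObserved_eq_count (π : Equiv.Perm (Fin N)) (e e' : Bool) :
    ddpObserved natRank (fun i => natRank (π i)) (halfAxis (natRank i) (N + 1) e)
      (halfAxis (natRank (π i)) (N + 1) e') =
      π.count (segment N e (bif e then N - natRank i else natRank i - 1))
        (segment N e' (bif e' then N - natRank (π i) else natRank (π i) - 1)) := by
  rw [ddpObserved, Equiv.Perm.count]
  congr 1
  ext j
  have h1 := i.isLt
  have h2 := (π i).isLt
  have h3 := j.isLt
  have h4 := (π j).isLt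
  rw [Finset.mem_filter, Finset.mem_filter]
  cases e <;> cases e' <;>
  simp only [halfAxis, cond_true, cond_false, Finset.mem_univ, true_and,
    mem_segment_false, mem_segment_true, natRank] <;> omega

theorem largeCorner_of_ddpScore (t : CellScore) (π : Equiv.Perm (Fin N)) (hN : 2 ≤ N)
    {c : ℝ} (hc : 0 < c) (hc1 : c ≤ 1)
    (hT : 4 * c ^ 2 * N ≤ ddpScore t natRank (fun i => natRank (π i)) {i}) :
    LargeCorner (c ^ 2) π := by
  have hN' : (2 : ℝ) ≤ N := by exact_mod_cast hN
  have hT' : 4 * c ^ 2 * (N - 1) ≤ ddpScore t natRank (fun i => natRank (π i)) {i} :=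
    hT.trans' (by gcongr; linarith)
  rw [ddpScore_singleton t .natRank (.natRank_perm π)] at hT'
  obtain ⟨e, e', h1, h2, h3⟩ :=
    (ddp_isTable .natRank (.natRank_perm π) hN).exists_large_dev t hc hc1 hT'
  rw [ddpObserved_eq_count π] at h3
  have h4 : ∀ v, 1 ≤ v → v ≤ N → ∀ e : Bool,
      ((bif e then N - v else v - 1 : ℕ) : ℝ) = bif e then (N : ℝ) - v else v - 1 := by
    intro v hv hvN e
    cases e
    · simp only [cond_false]; rw [Nat.cast_sub (by omega), Nat.cast_one]
    · simp only [cond_true]; rw [Nat.cast_sub (by omega)]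
  have hr1 := IsRanking.natRank.one_le i
  have hr2 := IsRanking.natRank.le i
  have hs1 := IsRanking.natRank.one_le (π i)
  have hs2 := IsRanking.natRank.le (π i)
  rw [← h4 _ hr1 hr2] at h1 h3
  rw [← h4 _ hs1 hs2] at h2 h3
  have h1 : 0 < (bif e then N - natRank i else natRank i - 1) := by exact_mod_cast h1
  have h2 : 0 < (bif e' then N - natRank (π i) else natRank (π i) - 1) := by exact_mod_cast h2
  refine ⟨e, e', _, _, ⟨h1, ?_⟩, ⟨h2, ?_⟩, h3.trans' ?_⟩
  · cases e <;> simp only [cond_true, cond_false] <;> omega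
  · cases e' <;> simp only [cond_true, cond_false] <;> omega
  -- Replacing `N - 1` by `N` in the denominator only lowers the expected count.
  · gcongr
    · linarith
    · linarith

theorem ddpScore_nonneg (t : CellScore) (hr : IsRanking r) (hs : IsRanking s) (hN : 2 ≤ N) :
    0 ≤ ddpScore t r s {i} := by
  rw [ddpScore_singleton t hr hs]
  exact (ddp_isTable hr hs hN).score_nonneg t

theorem le_ddpScore (t : CellScore) (hr : IsRanking r) (hs : IsRanking s) (hN : 2 ≤ N) :
    ((ddpObserved r s (0, r i) (0, s i) : ℝ) - (r i - 1) * (s i - 1) / (N - 1)) ^ 2 /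
      (4 * (N - 1)) ≤ ddpScore t r s {i} := by
  rw [ddpScore_singleton t hr hs]
  exact (ddp_isTable hr hs hN).sq_le_score t false false

theorem mem_ddpPartitions_two {I : Finset (Fin N)} : I ∈ ddpPartitions N 2 ↔ ∃ i, I = {i} := by
  simp [ddpPartitions, Finset.mem_powersetCard, Finset.card_eq_one]

theorem card_ddpPartitions_two : (ddpPartitions N 2).card = N := by
  simp [ddpPartitions]

end DDP

/-- A sum and a maximum over the same finite set, compared through the proportion `ρ` of large
terms. -/
theorem sum_lt_sum_and_sSup_lt_sSup {β : Type*} {S G : Finset β} {u v : β → ℝ} {ρ τ : ℝ}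
    (hS : S.Nonempty) (hG : G ⊆ S) (hρ : 0 < ρ) (hρ1 : ρ ≤ 1) (hτ : 0 < τ)
    (hcard : ρ * S.card ≤ G.card) (hu : ∀ I ∈ S, u I < ρ * τ) (hv : ∀ I ∈ S, 0 ≤ v I)
    (hvG : ∀ I ∈ G, τ ≤ v I) :
    ∑ I ∈ S, u I < ∑ I ∈ S, v I ∧ sSup (u '' (S : Set β)) < sSup (v '' (S : Set β)) := by
  constructor
  · calc ∑ I ∈ S, u I < ∑ I ∈ S, ρ * τ := Finset.sum_lt_sum_of_nonempty hS hu
      _ = ρ * S.card * τ := by rw [Finset.sum_const, nsmul_eq_mul]; ring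
      _ ≤ G.card * τ := by gcongr
      _ = ∑ I ∈ G, τ := by rw [Finset.sum_const, nsmul_eq_mul]
      _ ≤ ∑ I ∈ G, v I := Finset.sum_le_sum hvG
      _ ≤ ∑ I ∈ S, v I := Finset.sum_le_sum_of_subset_of_nonneg hG fun I hI _ => hv I hI
  · have hGne : G.Nonempty := by
      rw [← Finset.card_pos]
      have : 0 < ρ * S.card := by have := hS.card_pos; positivity
      exact_mod_cast this.trans_le hcard
    obtain ⟨I, hI⟩ := hGne
    have hfin : ∀ w : β → ℝ, (w '' (S : Set β)).Finite := fun w => S.finite_toSet.image w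
    obtain ⟨J, hJ, hJe⟩ := (Finset.coe_nonempty.2 hS).image u |>.csSup_mem (hfin u)
    calc sSup (u '' (S : Set β)) < ρ * τ := hJe ▸ hu J hJ
      _ ≤ τ := mul_le_of_le_one_left hτ.le hρ1
      _ ≤ v I := hvG I hI
      _ ≤ _ := le_csSup (hfin v).bddAbove ⟨I, hG hI, rfl⟩

end MinPTest

namespace MinPTest

/-! ### Permutation p-values -/

variable {N : ℕ}

/-- Permutation p-values are superuniform. -/
theorem card_pValue_le (T : (Fin N → ℕ) → (Fin N → ℕ) → ℝ) {c : ℝ} (hc : 0 ≤ c) :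
    ((Finset.univ.filter fun π : Equiv.Perm (Fin N) =>
      pValue T natRank (fun i => natRank (π i)) ≤ c).card : ℝ) ≤ c * N.factorial := by
  set S := Finset.univ.filter fun π : Equiv.Perm (Fin N) =>
    pValue T natRank (fun i => natRank (π i)) ≤ c with hS
  rcases S.eq_empty_or_nonempty with h | h
  · rw [h]; simp; positivity
  -- All of `S` has a statistic at least as large as that of `π₀`, so `S` lies in the set counted by
  -- the p-value of `π₀`, which is at most `c`.
  obtain ⟨π₀, h0, hmin⟩ := S.exists_min_image (fun π => T natRank (fun i => natRank (π i))) h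
  have h1 := (Finset.mem_filter.1 h0).2
  rw [pValue, div_le_iff₀ (by exact_mod_cast N.factorial_pos)] at h1
  refine le_trans ?_ h1
  exact_mod_cast Finset.card_le_card fun π hπ =>
    Finset.mem_filter.2 ⟨Finset.mem_univ _, hmin π hπ⟩

/-- If the minimum at a permutation is at most the observed one, then some p_m there is at most the
observed p_2. Each such event has probability at most p_2, whatever the dependence between different
m. -/
theorem minPTestPValue_le (T : ℕ → (Fin N → ℕ) → (Fin N → ℕ) → ℝ) {M : ℕ} (hM : 2 ≤ M)
    (r s : Fin N → ℕ) : minPTestPValue T M r s ≤ M * pValue (T 2) r s := by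
  have hfin : ∀ r s : Fin N → ℕ, ((fun m => pValue (T m) r s) '' Set.Icc 2 M).Finite :=
    fun r s => (Set.finite_Icc 2 M).image _
  have hne : ∀ r s : Fin N → ℕ, ((fun m => pValue (T m) r s) '' Set.Icc 2 M).Nonempty :=
    fun r s => (Set.nonempty_Icc.2 hM).image _
  have hle : minPValue T M r s ≤ pValue (T 2) r s :=
    csInf_le (hfin r s).bddBelow ⟨2, ⟨le_rfl, hM⟩, rfl⟩
  have hp : 0 ≤ pValue (T 2) r s := div_nonneg (Nat.cast_nonneg _) (Nat.cast_nonneg _)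
  rw [minPTestPValue, div_le_iff₀ (by exact_mod_cast N.factorial_pos)]
  have hsub : (Finset.univ.filter fun π : Equiv.Perm (Fin N) =>
      minPValue T M natRank (fun i => natRank (π i)) ≤ minPValue T M r s) ⊆
      (Finset.Icc 2 M).biUnion fun m => Finset.univ.filter fun π : Equiv.Perm (Fin N) =>
        pValue (T m) natRank (fun i => natRank (π i)) ≤ pValue (T 2) r s := by
    intro π hπ
    obtain ⟨m, hm, hme⟩ := (hne natRank (fun i => natRank (π i))).csInf_mem (hfin _ _)
    refine Finset.mem_biUnion.2 ⟨m, Finset.mem_Icc.2 hm, Finset.mem_filter.2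
      ⟨Finset.mem_univ _, ?_⟩⟩
    exact (hme.le.trans (Finset.mem_filter.1 hπ).2).trans hle
  calc _ ≤ (((Finset.Icc 2 M).biUnion fun m => Finset.univ.filter fun π : Equiv.Perm (Fin N) =>
        pValue (T m) natRank (fun i => natRank (π i)) ≤ pValue (T 2) r s).card : ℝ) := by
        exact_mod_cast Finset.card_le_card hsub
    _ ≤ ∑ m ∈ Finset.Icc 2 M, ((Finset.univ.filter fun π : Equiv.Perm (Fin N) =>
        pValue (T m) natRank (fun i => natRank (π i)) ≤ pValue (T 2) r s).card : ℝ) := by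
        exact_mod_cast Finset.card_biUnion_le
    _ ≤ (Finset.Icc 2 M).card * (pValue (T 2) r s * N.factorial) := by
        rw [← nsmul_eq_mul]
        exact Finset.sum_le_card_nsmul _ _ _ fun m _ => card_pValue_le (T m) hp
    _ ≤ M * (pValue (T 2) r s * N.factorial) := by
        gcongr
        rw [Nat.card_Icc]; omega
    _ = _ := by ring

open Classical in
theorem pValue_le_of_imp (T : (Fin N → ℕ) → (Fin N → ℕ) → ℝ) {r s : Fin N → ℕ}
    {B : Equiv.Perm (Fin N) → Prop}
    (h : ∀ π, T r s ≤ T natRank (fun i => natRank (π i)) → B π) {p : ℝ}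
    (hB : ((Finset.univ.filter B).card : ℝ) ≤ p * N.factorial) : pValue T r s ≤ p := by
  rw [pValue, div_le_iff₀ (by exact_mod_cast N.factorial_pos)]
  refine le_trans ?_ hB
  exact_mod_cast Finset.card_le_card fun π hπ =>
    Finset.mem_filter.2 ⟨Finset.mem_univ _, h π (Finset.mem_filter.1 hπ).2⟩

end MinPTest

/-! ### Distribution functions that factorize almost surely -/

theorem integral_Iic_eq_add_interval {u : ℝ → ℝ} (hu : Integrable u) (x : ℝ) :
    ∫ s in Set.Iic x, u s = (∫ s in Set.Iic 0, u s) + ∫ s in (0:ℝ)..x, u s := by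
  rw [← intervalIntegral.integral_Iic_sub_Iic hu.integrableOn hu.integrableOn]; ring

theorem continuous_integral_Iic {u : ℝ → ℝ} (hu : Integrable u) :
    Continuous fun x => ∫ s in Set.Iic x, u s := by
  rw [funext (integral_Iic_eq_add_interval hu)]
  exact continuous_const.add
    (intervalIntegral.continuous_primitive (fun a b => hu.intervalIntegrable) 0)

/-- Almost everywhere the primitive has derivative `u x`. Where this is non-zero, a zero of the
primitive is isolated among its zeros, whereas a set of positive measure has a point all of whose
neighbourhoods meet it in positive measure. -/
theorem ae_zero_of_integral_Iic_eq_zero {u : ℝ → ℝ} (hu : Integrable u) :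
    ∀ᵐ x, ∫ s in Set.Iic x, u s = 0 → u x = 0 := by
  have h1 := LocallyIntegrable.ae_hasDerivAt_integral hu.locallyIntegrable
  set U : ℝ → ℝ := fun x => ∫ s in Set.Iic x, u s with hUdef
  have hder : ∀ᵐ x, HasDerivAt U (u x) x := by
    filter_upwards [h1] with x hx
    exact (hx 0).const_add (∫ s in Set.Iic 0, u s) |>.congr_of_eventuallyEq
      (Eventually.of_forall (integral_Iic_eq_add_interval hu))
  set S : Set ℝ := {x | U x = 0 ∧ HasDerivAt U (u x) x ∧ u x ≠ 0} with hS
  have hS0 : volume S = 0 := by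
    by_contra hne
    obtain ⟨x, hx, hpos⟩ := exists_mem_forall_mem_nhdsWithin_pos_measure hne
    have h2 : ∀ᶠ z in 𝓝[≠] x, U z ≠ 0 := hx.2.1.eventually_ne hx.2.2
    have h3 : ({x} : Set ℝ) ∈ 𝓝[S] x := by
      rw [eventually_nhdsWithin_iff] at h2
      rw [mem_nhdsWithin_iff_eventually]
      filter_upwards [h2] with z hz hzS
      by_contra hzx
      exact hz hzx hzS.1
    have := hpos _ h3
    simp at this
  have h4 : ∀ᵐ x, x ∉ S := measure_eq_zero_iff_ae_notMem.1 hS0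
  filter_upwards [h4, hder] with x hx hd h0
  by_contra hne
  exact hx ⟨h0, hd, hne⟩

/-- The one-dimensional statement is used twice, with `V` the integral over the first variable
alone: first in the second variable, to pass from the quadrant integral to `V`, then in the first,
to pass from `V` to `k`. -/
theorem ae_zero_of_integral_quadrant_eq_zero {k : ℝ × ℝ → ℝ} (hkm : Measurable k)
    (hk : Integrable k (volume.prod volume)) :
    ∀ᵐ z, ∫ w in Set.Iic z.1 ×ˢ Set.Iic z.2, k w ∂(volume.prod volume) = 0 → k z = 0 := by
  set V : ℝ × ℝ → ℝ := fun z => ∫ s in Set.Iic z.1, k (s, z.2) with hV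
  -- The moving domain of integration is absorbed into a jointly measurable indicator.
  have hVm : Measurable V := by
    have h1 : StronglyMeasurable
        (Set.indicator {q : (ℝ × ℝ) × ℝ | q.2 ≤ q.1.1} (fun q => k (q.2, q.1.2))) :=
      ((hkm.comp (by fun_prop)).indicator
        (measurableSet_le (by fun_prop) (by fun_prop))).stronglyMeasurable
    have h2 := (h1.integral_prod_right' (ν := volume)).measurable
    convert h2 using 2 with z
    rw [hV]
    simp only
    rw [← integral_indicator measurableSet_Iic]
    rfl
  have hW : ∀ z : ℝ × ℝ, ∫ w in Set.Iic z.1 ×ˢ Set.Iic z.2, k w ∂(volume.prod volume) =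
      ∫ t in Set.Iic z.2, V (z.1, t) := by
    intro z
    rw [← setIntegral_prod_swap, setIntegral_prod (fun z => k z.swap) hk.swap.integrableOn]
    rfl
  set W : ℝ × ℝ → ℝ := fun z => ∫ t in Set.Iic z.2, V (z.1, t) with hWd
  have hWm : Measurable W := by
    have h1 : StronglyMeasurable
        (Set.indicator {q : (ℝ × ℝ) × ℝ | q.2 ≤ q.1.2} (fun q => V (q.1.1, q.2))) :=
      ((hVm.comp (by fun_prop)).indicator
        (measurableSet_le (by fun_prop) (by fun_prop))).stronglyMeasurable
    have h2 := (h1.integral_prod_right' (ν := volume)).measurable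
    convert h2 using 2 with z
    rw [hWd]
    simp only
    rw [← integral_indicator measurableSet_Iic]
    rfl
  have step1 : ∀ᵐ z, W z = 0 → V z = 0 := by
    rw [Measure.volume_eq_prod, Measure.ae_prod_iff_ae_ae
      ((measurableSet_eq_fun hWm measurable_const).imp (measurableSet_eq_fun hVm measurable_const))]
    refine Eventually.of_forall fun x => ?_
    have hVx : Integrable fun t => V (x, t) := by
      have h1 : Integrable k ((volume.restrict (Set.Iic x)).prod volume) := by
        have := hk.restrict (s := Set.Iic x ×ˢ Set.univ)
        rwa [← Measure.prod_restrict, Measure.restrict_univ] at this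
      exact h1.integral_prod_right
    exact ae_zero_of_integral_Iic_eq_zero hVx
  have step2 : ∀ᵐ z, V z = 0 → k z = 0 := by
    -- The coordinates are swapped so that the second is the one held fixed when slicing.
    have hsw : ∀ᵐ z : ℝ × ℝ, V z.swap = 0 → k z.swap = 0 := by
      have hm : MeasurableSet {z : ℝ × ℝ | V z.swap = 0 → k z.swap = 0} :=
        (measurableSet_eq_fun (hVm.comp measurable_swap) measurable_const).imp
          (measurableSet_eq_fun (hkm.comp measurable_swap) measurable_const)
      rw [Measure.volume_eq_prod, Measure.ae_prod_iff_ae_ae hm]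
      filter_upwards [hk.prod_left_ae] with y hy
      exact ae_zero_of_integral_Iic_eq_zero hy
    rw [Measure.volume_eq_prod] at hsw ⊢
    exact (Measure.measurePreserving_swap (μ := (volume : Measure ℝ))
      (ν := (volume : Measure ℝ))).quasiMeasurePreserving.ae hsw |>.mono fun z hz => by
        simpa using hz
  filter_upwards [step1, step2] with z h1 h2 h3
  rw [hW] at h3
  exact h2 (h1 h3)

/-! ### Densities and the gap between joint and product distribution functions. -/

section Density

variable {E : Type*} [MeasurableSpace E] {ν : Measure E} {h : E → ℝ}

theorem integrable_of_isProbabilityMeasure_withDensity (hm : Measurable h) (h0 : ∀ z, 0 ≤ h z)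
    [IsProbabilityMeasure (ν.withDensity fun z => ENNReal.ofReal (h z))] : Integrable h ν := by
  refine ⟨hm.aestronglyMeasurable, ?_⟩
  rw [hasFiniteIntegral_iff_ofReal (Eventually.of_forall h0)]
  have := measure_univ (μ := ν.withDensity fun z => ENNReal.ofReal (h z))
  rw [withDensity_apply _ MeasurableSet.univ, Measure.restrict_univ] at this
  simp [this]

theorem withDensity_ofReal_real (hm : Measurable h) (h0 : ∀ z, 0 ≤ h z) {s : Set E}
    (hs : MeasurableSet s) :
    (ν.withDensity fun z => ENNReal.ofReal (h z)).real s = ∫ z in s, h z ∂ν := by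
  rw [integral_eq_lintegral_of_nonneg_ae (Eventually.of_forall h0) hm.aestronglyMeasurable,
    measureReal_def, withDensity_apply _ hs]

end Density

/-- The joint distribution function minus the product of the marginal ones. -/
noncomputable def cdfGap (μ : Measure (ℝ × ℝ)) (μX μY : Measure ℝ) (z : ℝ × ℝ) : ℝ :=
  μ.real (Set.Iic z.1 ×ˢ Set.Iic z.2) - μX.real (Set.Iic z.1) * μY.real (Set.Iic z.2)

section Gap

variable {h : ℝ × ℝ → ℝ} {f g : ℝ → ℝ}

theorem cdfGap_withDensity (h_meas : Measurable h) (f_meas : Measurable f) (g_meas : Measurable g)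
    (h_nonneg : ∀ z, 0 ≤ h z) (f_nonneg : ∀ x, 0 ≤ f x) (g_nonneg : ∀ y, 0 ≤ g y)
    (hh : Integrable h) (hf : Integrable f) (hg : Integrable g) (z : ℝ × ℝ) :
    cdfGap (volume.withDensity fun z => ENNReal.ofReal (h z))
      (volume.withDensity fun x => ENNReal.ofReal (f x))
      (volume.withDensity fun y => ENNReal.ofReal (g y)) z =
    ∫ w in Set.Iic z.1 ×ˢ Set.Iic z.2, (h w - f w.1 * g w.2) ∂(volume.prod volume) := by
  rw [cdfGap, withDensity_ofReal_real h_meas h_nonneg (measurableSet_Iic.prod measurableSet_Iic),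
    withDensity_ofReal_real f_meas f_nonneg measurableSet_Iic,
    withDensity_ofReal_real g_meas g_nonneg measurableSet_Iic, integral_sub,
    setIntegral_prod_mul, Measure.volume_eq_prod]
  · exact hh.integrableOn
  · exact (hf.mul_prod hg).integrableOn

/-- If the joint distribution function is almost surely the product of the marginal ones, then
the joint density is almost everywhere the product of the marginal densities. -/
theorem density_ae_eq_of_cdfGap_ae_eq_zero
    (h_meas : Measurable h) (f_meas : Measurable f) (g_meas : Measurable g)
    (h_nonneg : ∀ z, 0 ≤ h z) (f_nonneg : ∀ x, 0 ≤ f x) (g_nonneg : ∀ y, 0 ≤ g y)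
    [hμ : IsProbabilityMeasure (volume.withDensity fun z => ENNReal.ofReal (h z))]
    [hμX : IsProbabilityMeasure (volume.withDensity fun x => ENNReal.ofReal (f x))]
    [hμY : IsProbabilityMeasure (volume.withDensity fun y => ENNReal.ofReal (g y))]
    (hgap : ∀ᵐ z ∂(volume.withDensity fun z => ENNReal.ofReal (h z)),
      cdfGap (volume.withDensity fun z => ENNReal.ofReal (h z))
        (volume.withDensity fun x => ENNReal.ofReal (f x))
        (volume.withDensity fun y => ENNReal.ofReal (g y)) z = 0) :
    h =ᵐ[volume] fun z => f z.1 * g z.2 := by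
  have hh := integrable_of_isProbabilityMeasure_withDensity (ν := volume) h_meas h_nonneg
  have hf := integrable_of_isProbabilityMeasure_withDensity (ν := volume) f_meas f_nonneg
  have hg := integrable_of_isProbabilityMeasure_withDensity (ν := volume) g_meas g_nonneg
  have hfg : Integrable (fun z : ℝ × ℝ => f z.1 * g z.2) := hf.mul_prod hg
  -- The hypothesis concerns only points charged by the law, so nothing is obtained yet on {h = 0}.
  have h1 : ∀ᵐ z, h z ≠ 0 → h z - f z.1 * g z.2 = 0 := by
    have h2 := ae_zero_of_integral_quadrant_eq_zero
      (k := fun z => h z - f z.1 * g z.2) (by fun_prop) (hh.sub hfg)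
    rw [ae_withDensity_iff (by fun_prop)] at hgap
    filter_upwards [h2, hgap] with z hz hgz hne
    refine hz ?_
    rw [← cdfGap_withDensity h_meas f_meas g_meas h_nonneg f_nonneg g_nonneg hh hf hg]
    refine hgz ?_
    simpa using lt_of_le_of_ne (h_nonneg z) hne.symm
  -- On {h = 0} the inequality is free; equality then follows because both sides have integral 1.
  have hle : h ≤ᵐ[volume] fun z => f z.1 * g z.2 := by
    filter_upwards [h1] with z hz
    by_cases h0 : h z = 0
    · rw [h0]; exact mul_nonneg (f_nonneg _) (g_nonneg _)
    · linarith [hz h0]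
  have hint1 : ∫ z, h z = 1 := by
    rw [← setIntegral_univ, ← withDensity_ofReal_real h_meas h_nonneg MeasurableSet.univ]
    simp
  have hint2 : ∫ z : ℝ × ℝ, f z.1 * g z.2 = 1 := by
    rw [Measure.volume_eq_prod, integral_prod_mul, ← setIntegral_univ,
      ← withDensity_ofReal_real f_meas f_nonneg MeasurableSet.univ, ← setIntegral_univ,
      ← withDensity_ofReal_real g_meas g_nonneg MeasurableSet.univ]
    simp
  exact (integral_eq_iff_of_ae_le hh hfg hle).1 (hint1.trans hint2.symm)

/-- A non-null set contains a point all of whose neighbourhoods are charged. The point found lies in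
the support of the law but need not be near (x₀, y₀). -/
theorem exists_cdfGap_ne_zero
    (h_meas : Measurable h) (f_meas : Measurable f) (g_meas : Measurable g)
    (h_nonneg : ∀ z, 0 ≤ h z) (f_nonneg : ∀ x, 0 ≤ f x) (g_nonneg : ∀ y, 0 ≤ g y)
    [hμ : IsProbabilityMeasure (volume.withDensity fun z => ENNReal.ofReal (h z))]
    [hμX : IsProbabilityMeasure (volume.withDensity fun x => ENNReal.ofReal (f x))]
    [hμY : IsProbabilityMeasure (volume.withDensity fun y => ENNReal.ofReal (g y))]
    {x₀ y₀ : ℝ} (h_cont : ContinuousAt h (x₀, y₀))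
    (f_cont : ContinuousAt f x₀) (g_cont : ContinuousAt g y₀)
    (dep : h (x₀, y₀) ≠ f x₀ * g y₀) :
    ∃ z, cdfGap (volume.withDensity fun z => ENNReal.ofReal (h z))
        (volume.withDensity fun x => ENNReal.ofReal (f x))
        (volume.withDensity fun y => ENNReal.ofReal (g y)) z ≠ 0 ∧
      ∀ s ∈ 𝓝 z, 0 < (volume.withDensity fun z => ENNReal.ofReal (h z)) s := by
  by_contra! H
  have hgap : ∀ᵐ z ∂(volume.withDensity fun z => ENNReal.ofReal (h z)),
      cdfGap (volume.withDensity fun z => ENNReal.ofReal (h z))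
        (volume.withDensity fun x => ENNReal.ofReal (f x))
        (volume.withDensity fun y => ENNReal.ofReal (g y)) z = 0 := by
    by_contra hne
    rw [ae_iff] at hne
    obtain ⟨z, hz, hpos⟩ := exists_mem_forall_mem_nhdsWithin_pos_measure hne
    obtain ⟨s, hs, hs0⟩ := H z hz
    exact (hpos s (mem_nhdsWithin_of_mem_nhds hs)).not_ge hs0
  have hae := density_ae_eq_of_cdfGap_ae_eq_zero h_meas f_meas g_meas h_nonneg f_nonneg g_nonneg
    hgap
  have hc : ContinuousAt (fun z : ℝ × ℝ => f z.1 * g z.2) (x₀, y₀) :=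
    (f_cont.comp (x := (x₀, y₀)) (f := Prod.fst) continuousAt_fst).mul
      (g_cont.comp (x := (x₀, y₀)) (f := Prod.snd) continuousAt_snd)
  have hev : ∀ᶠ z in 𝓝 (x₀, y₀), h z ≠ f z.1 * g z.2 := by
    filter_upwards [(h_cont.sub hc).eventually_ne (sub_ne_zero.2 dep)] with z hz
    exact sub_ne_zero.1 hz
  have h0 : volume {z : ℝ × ℝ | h z ≠ f z.1 * g z.2} = 0 := hae
  exact (Measure.measure_pos_of_mem_nhds volume hev).ne' h0

end Gap

/-- A box of positive mass on which the sign of the gap is certified by the corners. -/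
theorem exists_box_of_cdfGap_ne_zero {μ : Measure (ℝ × ℝ)} [IsProbabilityMeasure μ]
    {μX μY : Measure ℝ} (hX : μ.map Prod.fst = μX) (hY : μ.map Prod.snd = μY)
    (hFc : Continuous fun x => μX.real (Set.Iic x)) (hGc : Continuous fun y => μY.real (Set.Iic y))
    {z : ℝ × ℝ} (hz : cdfGap μ μX μY z ≠ 0) (hpos : ∀ s ∈ 𝓝 z, 0 < μ s) :
    ∃ x x' y y' : ℝ, 0 < μ.real (Set.Ioc x x' ×ˢ Set.Ioc y y') ∧
      (μX.real (Set.Iic x') * μY.real (Set.Iic y') < μ.real (Set.Iic x ×ˢ Set.Iic y) ∨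
        μ.real (Set.Iic x' ×ˢ Set.Iic y') < μX.real (Set.Iic x) * μY.real (Set.Iic y)) := by
  -- Enlarging a quadrant adds at most the masses of a vertical and a horizontal strip, so the joint
  -- distribution function inherits the continuity of the marginal ones.
  have hdiff : ∀ x x' y y' : ℝ, x ≤ x' → y ≤ y' → μ.real (Set.Iic x' ×ˢ Set.Iic y') ≤
      μ.real (Set.Iic x ×ˢ Set.Iic y) + (μX.real (Set.Iic x') - μX.real (Set.Iic x)) +
        (μY.real (Set.Iic y') - μY.real (Set.Iic y)) := by
    intro x x' y y' hx hy
    rw [← hX, ← hY]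
    have e1 : (μ.map Prod.fst).real (Set.Iic x') - (μ.map Prod.fst).real (Set.Iic x) =
        μ.real (Prod.fst ⁻¹' Set.Ioc x x') := by
      rw [map_measureReal_apply measurable_fst measurableSet_Iic,
        map_measureReal_apply measurable_fst measurableSet_Iic,
        ← measureReal_sdiff (Set.preimage_mono (Set.Iic_subset_Iic.2 hx))
          (measurable_fst measurableSet_Iic), ← Set.preimage_sdiff, Set.Iic_sdiff_Iic]
    have e2 : (μ.map Prod.snd).real (Set.Iic y') - (μ.map Prod.snd).real (Set.Iic y) =
        μ.real (Prod.snd ⁻¹' Set.Ioc y y') := by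
      rw [map_measureReal_apply measurable_snd measurableSet_Iic,
        map_measureReal_apply measurable_snd measurableSet_Iic,
        ← measureReal_sdiff (Set.preimage_mono (Set.Iic_subset_Iic.2 hy))
          (measurable_snd measurableSet_Iic), ← Set.preimage_sdiff, Set.Iic_sdiff_Iic]
    rw [e1, e2]
    refine (measureReal_mono ?_).trans ((measureReal_union_le _ _).trans
      (add_le_add_left (measureReal_union_le _ _) _))
    rintro ⟨s, t⟩ ⟨h1, h2⟩
    simp only [Set.mem_Iic] at h1 h2
    by_cases h3 : s ≤ x
    · by_cases h4 : t ≤ y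
      · exact Or.inl (Or.inl ⟨h3, h4⟩)
      · exact Or.inr ⟨not_le.1 h4, h2⟩
    · exact Or.inl (Or.inr ⟨not_le.1 h3, h1⟩)
  set F := fun x => μX.real (Set.Iic x) with hF
  set G := fun y => μY.real (Set.Iic y) with hG
  obtain ⟨a, b⟩ := z
  simp only [cdfGap] at hz
  -- Joint and product functions are both monotone, so comparing one at the lower corner with the
  -- other at the upper corner controls the whole box. The strict inequality at the centre survives
  -- for small ε.
  have key : ∀ᶠ ε in 𝓝[>] (0 : ℝ),
      (F (a + ε) * G (b + ε) < μ.real (Set.Iic (a - ε) ×ˢ Set.Iic (b - ε)) ∨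
        μ.real (Set.Iic (a + ε) ×ˢ Set.Iic (b + ε)) < F (a - ε) * G (b - ε)) := by
    have c1 : Continuous fun ε => F (a + ε) := hFc.comp (by fun_prop)
    have c2 : Continuous fun ε => F (a - ε) := hFc.comp (by fun_prop)
    have c3 : Continuous fun ε => G (b + ε) := hGc.comp (by fun_prop)
    have c4 : Continuous fun ε => G (b - ε) := hGc.comp (by fun_prop)
    rcases lt_or_gt_of_ne hz with hz | hz
    · have hc : Continuous fun ε => F (a - ε) * G (b - ε) - (μ.real (Set.Iic a ×ˢ Set.Iic b) +
          (F (a + ε) - F a) + (G (b + ε) - G b)) := by fun_prop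
      have : ∀ᶠ ε in 𝓝 (0 : ℝ), 0 < F (a - ε) * G (b - ε) - (μ.real (Set.Iic a ×ˢ Set.Iic b) +
          (F (a + ε) - F a) + (G (b + ε) - G b)) := by
        refine (hc.tendsto 0).eventually_const_lt ?_
        simp only [sub_zero, add_zero, sub_self]
        change 0 < μX.real (Set.Iic a) * μY.real (Set.Iic b) - _
        linarith
      filter_upwards [this.filter_mono nhdsWithin_le_nhds, self_mem_nhdsWithin] with ε hε h0
      right
      have h1 := hdiff a (a + ε) b (b + ε) (by linarith [Set.mem_Ioi.1 h0])
        (by linarith [Set.mem_Ioi.1 h0])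
      simp only [hF, hG] at hε ⊢
      linarith
    · have hc : Continuous fun ε => μ.real (Set.Iic a ×ˢ Set.Iic b) -
          (F a - F (a - ε)) - (G b - G (b - ε)) - F (a + ε) * G (b + ε) := by fun_prop
      have : ∀ᶠ ε in 𝓝 (0 : ℝ), 0 < μ.real (Set.Iic a ×ˢ Set.Iic b) -
          (F a - F (a - ε)) - (G b - G (b - ε)) - F (a + ε) * G (b + ε) := by
        refine (hc.tendsto 0).eventually_const_lt ?_
        simp only [sub_zero, add_zero, sub_self]
        change 0 < _ - μX.real (Set.Iic a) * μY.real (Set.Iic b)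
        linarith
      filter_upwards [this.filter_mono nhdsWithin_le_nhds, self_mem_nhdsWithin] with ε hε h0
      left
      have h1 := hdiff (a - ε) a (b - ε) b (by linarith [Set.mem_Ioi.1 h0])
        (by linarith [Set.mem_Ioi.1 h0])
      simp only [hF, hG] at hε ⊢
      linarith
  obtain ⟨ε, hε, h0⟩ := (key.and self_mem_nhdsWithin).exists
  have h0 : 0 < ε := h0
  refine ⟨a - ε, a + ε, b - ε, b + ε, ?_, hε⟩
  rw [measureReal_def, ENNReal.toReal_pos_iff]
  exact ⟨hpos _ (prod_mem_nhds (Ioc_mem_nhds (by linarith) (by linarith))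
    (Ioc_mem_nhds (by linarith) (by linarith))), measure_lt_top _ _⟩

namespace MinPTest

/-! ### Samples with a visible local dependence -/

section Rank

variable {N : ℕ} {x : Fin N → ℝ}

theorem rank_le_card {i : Fin N} {c : ℝ} (h : x i ≤ c) :
    rank x i ≤ (Finset.univ.filter fun j => x j ≤ c).card :=
  Finset.card_le_card fun j hj => by
    simp only [Finset.mem_filter, Finset.mem_univ, true_and] at hj ⊢
    exact hj.trans h

theorem card_lt_rank {i : Fin N} {c : ℝ} (h : c < x i) :
    (Finset.univ.filter fun j => x j ≤ c).card < rank x i := by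
  refine Finset.card_lt_card ((Finset.ssubset_iff_of_subset fun j hj => ?_).2 ⟨i, ?_, ?_⟩)
  · simp only [Finset.mem_filter, Finset.mem_univ, true_and] at hj ⊢
    exact hj.trans h.le
  · simp
  · simpa using h

theorem isRanking_rank (hx : Function.Injective x) : IsRanking (rank x) where
  injective i j h := by
    rcases lt_trichotomy (x i) (x j) with h1 | h1 | h1
    · exact absurd h (card_lt_rank h1).ne
    · exact hx h1
    · exact absurd h (card_lt_rank h1).ne'
  mem i := by
    rw [Finset.mem_Icc]
    refine ⟨Finset.card_pos.2 ⟨i, by simp⟩, ?_⟩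
    exact (Finset.card_le_univ _).trans (by simp)

end Rank

/-- In the sample `(x i, y i)`, the counts at the corners of the box `(l, l'] × (k, k']` certify a
gap `δ` between the joint and the product empirical distribution functions throughout the box, and
the box contains at least the proportion `ρ` of the sample. -/
structure GapBox {N : ℕ} (x y : Fin N → ℝ) (l l' k k' δ ρ : ℝ) : Prop where
  gap : δ * N + ((Finset.univ.filter fun i => x i ≤ l').card : ℝ) *
        (Finset.univ.filter fun i => y i ≤ k').card / N ≤
      (Finset.univ.filter fun i => x i ≤ l ∧ y i ≤ k).card ∨
    δ * N + (Finset.univ.filter fun i => x i ≤ l' ∧ y i ≤ k').card ≤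
      ((Finset.univ.filter fun i => x i ≤ l).card : ℝ) *
        (Finset.univ.filter fun i => y i ≤ k).card / N
  box : ρ * N ≤ (Finset.univ.filter fun i => (l < x i ∧ x i ≤ l') ∧ (k < y i ∧ y i ≤ k')).card

section Sample

variable {N : ℕ} {x y : Fin N → ℝ} {l l' k k' δ ρ : ℝ}

/-- The lower left cell is squeezed between the quadrants at the two corners of the box, and its
expected count between the corresponding products, so its deviation is at least δN. This needs no
uniform law of large numbers. -/
theorem GapBox.le_adpScore (h : GapBox x y l l' k k' δ ρ) (t : CellScore)
    (hx : Function.Injective x) (hy : Function.Injective y) (hN : 2 ≤ N) (hδ : 0 < δ) {a b : ℕ}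
    (ha : a ∈ Finset.Ioo (Finset.univ.filter fun i => x i ≤ l).card
      (Finset.univ.filter fun i => x i ≤ l').card)
    (hb : b ∈ Finset.Ioo (Finset.univ.filter fun i => y i ≤ k).card
      (Finset.univ.filter fun i => y i ≤ k').card)
    (haN : a ∈ Finset.Icc 1 (N - 1)) (hbN : b ∈ Finset.Icc 1 (N - 1)) :
    δ ^ 2 / 4 * N ≤ adpScore t (rank x) (rank y) ({a}, {b}) := by
  have hN0 : (0 : ℝ) < N := by exact_mod_cast (by omega : 0 < N)
  rw [Finset.mem_Ioo] at ha hb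
  refine le_trans ?_ (MinPTest.le_adpScore t (isRanking_rank hx) (isRanking_rank hy) haN hbN)
  have h1 : (Finset.univ.filter fun i => x i ≤ l ∧ y i ≤ k).card ≤
      adpObserved (rank x) (rank y) (0, a) (0, b) :=
    Finset.card_le_card fun i hi => by
      simp only [Finset.mem_filter, Finset.mem_univ, true_and] at hi ⊢
      exact ⟨⟨(isRanking_rank hx).one_le i, (rank_le_card hi.1).trans ha.1.le⟩,
        ⟨(isRanking_rank hy).one_le i, (rank_le_card hi.2).trans hb.1.le⟩⟩
  have h2 : adpObserved (rank x) (rank y) (0, a) (0, b) ≤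
      (Finset.univ.filter fun i => x i ≤ l' ∧ y i ≤ k').card :=
    Finset.card_le_card fun i hi => by
      simp only [Finset.mem_filter, Finset.mem_univ, true_and] at hi ⊢
      constructor <;> by_contra! hc
      · exact absurd (card_lt_rank hc) (by omega)
      · exact absurd (card_lt_rank hc) (by omega)
  have h1' : ((Finset.univ.filter fun i => x i ≤ l ∧ y i ≤ k).card : ℝ) ≤
    adpObserved (rank x) (rank y) (0, a) (0, b) := by exact_mod_cast h1
  have h2' : (adpObserved (rank x) (rank y) (0, a) (0, b) : ℝ) ≤
    (Finset.univ.filter fun i => x i ≤ l' ∧ y i ≤ k').card := by exact_mod_cast h2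
  have h3 : (a * b / N : ℝ) ≤ ((Finset.univ.filter fun i => x i ≤ l').card : ℝ) *
      (Finset.univ.filter fun i => y i ≤ k').card / N := by
    gcongr <;> omega
  have h4 : ((Finset.univ.filter fun i => x i ≤ l).card : ℝ) *
      (Finset.univ.filter fun i => y i ≤ k).card / N ≤ a * b / N := by
    gcongr <;> omega
  have h5 : (δ * N) ^ 2 ≤
      ((adpObserved (rank x) (rank y) (0, a) (0, b) : ℝ) - a * b / N) ^ 2 := by
    rw [sq_le_sq, abs_of_pos (by positivity), le_abs]
    rcases h.gap with hg | hg
    · left; linarith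
    · right; linarith
  rw [le_div_iff₀ (by positivity)]
  refine le_trans (le_of_eq ?_) h5
  ring

theorem GapBox.le_ddpScore (h : GapBox x y l l' k k' δ ρ) (t : CellScore)
    (hx : Function.Injective x) (hy : Function.Injective y) (hN : 2 ≤ N) (hδ : 0 < δ) {i : Fin N}
    (hi : (l < x i ∧ x i ≤ l') ∧ (k < y i ∧ y i ≤ k')) :
    δ ^ 2 / 4 * N ≤ ddpScore t (rank x) (rank y) {i} := by
  have hN2 : (2 : ℝ) ≤ N := by exact_mod_cast hN
  have hN0 : (0 : ℝ) < N := by linarith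
  have hN1 : (0 : ℝ) < N - 1 := by linarith
  refine le_trans ?_ (MinPTest.le_ddpScore t (isRanking_rank hx) (isRanking_rank hy) hN)
  have hr1 := card_lt_rank hi.1.1
  have hr2 := rank_le_card hi.1.2
  have hs1 := card_lt_rank hi.2.1
  have hs2 := rank_le_card hi.2.2
  have hrN := (isRanking_rank hx).le i
  have hr0 := (isRanking_rank hx).one_le i
  have hs0 := (isRanking_rank hy).one_le i
  set r := rank x i with hr
  set s := rank y i with hs
  have h1 : (Finset.univ.filter fun i => x i ≤ l ∧ y i ≤ k).card ≤
      ddpObserved (rank x) (rank y) (0, r) (0, s) :=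
    Finset.card_le_card fun j hj => by
      simp only [Finset.mem_filter, Finset.mem_univ, true_and] at hj ⊢
      exact ⟨⟨(isRanking_rank hx).one_le j, (rank_le_card hj.1).trans_lt hr1⟩,
        ⟨(isRanking_rank hy).one_le j, (rank_le_card hj.2).trans_lt hs1⟩⟩
  have h2 : ddpObserved (rank x) (rank y) (0, r) (0, s) ≤
      (Finset.univ.filter fun i => x i ≤ l' ∧ y i ≤ k').card :=
    Finset.card_le_card fun j hj => by
      simp only [Finset.mem_filter, Finset.mem_univ, true_and] at hj ⊢
      constructor <;> by_contra! hc
      · exact absurd (card_lt_rank hc) (by omega)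
      · exact absurd (card_lt_rank hc) (by omega)
  have h1' : ((Finset.univ.filter fun i => x i ≤ l ∧ y i ≤ k).card : ℝ) ≤
    ddpObserved (rank x) (rank y) (0, r) (0, s) := by exact_mod_cast h1
  have h2' : (ddpObserved (rank x) (rank y) (0, r) (0, s) : ℝ) ≤
    (Finset.univ.filter fun i => x i ≤ l' ∧ y i ≤ k').card := by exact_mod_cast h2
  have hr0' : (1 : ℝ) ≤ r := by exact_mod_cast hr0
  have hs0' : (1 : ℝ) ≤ s := by exact_mod_cast hs0
  have hrN' : (r : ℝ) ≤ N := by exact_mod_cast hrN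
  have h3 : ((r - 1) * (s - 1) / (N - 1) : ℝ) ≤
      ((Finset.univ.filter fun i => x i ≤ l').card : ℝ) *
      (Finset.univ.filter fun i => y i ≤ k').card / N := by
    -- As r ≤ N, discarding the defining observation only lowers the relative rank.
    have e1 : ((r : ℝ) - 1) / (N - 1) ≤ r / N := by
      rw [div_le_div_iff₀ hN1 hN0]; linarith
    calc ((r - 1) * (s - 1) / (N - 1) : ℝ) = (r - 1) / (N - 1) * (s - 1) := by ring
      _ ≤ r / N * s := by gcongr; linarith
      _ = (r : ℝ) * s / N := by ring
      _ ≤ _ := by gcongr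
  have h4 : ((Finset.univ.filter fun i => x i ≤ l).card : ℝ) *
      (Finset.univ.filter fun i => y i ≤ k).card / N ≤ (r - 1) * (s - 1) / (N - 1) := by
    have e1 : ((Finset.univ.filter fun i => x i ≤ l).card : ℝ) ≤ r - 1 := by
      rw [le_sub_iff_add_le]; exact_mod_cast hr1
    have e2 : ((Finset.univ.filter fun i => y i ≤ k).card : ℝ) ≤ s - 1 := by
      rw [le_sub_iff_add_le]; exact_mod_cast hs1
    gcongr
    linarith
  have h5 : (δ * N) ^ 2 ≤
      ((ddpObserved (rank x) (rank y) (0, r) (0, s) : ℝ) - (r - 1) * (s - 1) / (N - 1)) ^ 2 := by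
    rw [sq_le_sq, abs_of_pos (by positivity), le_abs]
    rcases h.gap with hg | hg
    · left; linarith
    · right; linarith
  rw [le_div_iff₀ (by positivity)]
  refine le_trans ?_ h5
  have : 0 ≤ δ ^ 2 * N := by positivity
  nlinarith

/-- On such a sample the statistics exceed those at every permutation without a large corner. -/
theorem GapBox.adp_lt (h : GapBox x y l l' k k' δ ρ) (t : CellScore)
    (hx : Function.Injective x) (hy : Function.Injective y) (hN : 2 ≤ N) (hδ : 0 < δ)
    (hρ : 0 < ρ) (hρ1 : ρ ≤ 1) (hρN : 2 ≤ ρ * N) {c : ℝ} (hc : 0 < c) (hc1 : c ≤ 1)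
    (hcδ : 4 * c ^ 2 ≤ ρ ^ 2 / 4 * (δ ^ 2 / 4)) {π : Equiv.Perm (Fin N)}
    (hπ : ¬ LargeCorner (c ^ 2) π) :
    sumADP t 2 natRank (fun i => natRank (π i)) < sumADP t 2 (rank x) (rank y) ∧
      maxADP t 2 natRank (fun i => natRank (π i)) < maxADP t 2 (rank x) (rank y) := by
  have hN2 : (2 : ℝ) ≤ N := by exact_mod_cast hN
  set p := (Finset.univ.filter fun i => x i ≤ l).card with hp
  set p' := (Finset.univ.filter fun i => x i ≤ l').card with hp'
  set q := (Finset.univ.filter fun i => y i ≤ k).card with hq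
  set q' := (Finset.univ.filter fun i => y i ≤ k').card with hq'
  -- The open rank interval loses at most one value, which `2 ≤ ρ * N` absorbs: ρN - 1 ≥ (ρ/2)N.
  have hside : ∀ (z : Fin N → ℝ) (m m' : ℝ), ρ * N ≤
      (Finset.univ.filter fun i => m < z i ∧ z i ≤ m').card →
      ρ / 2 * (N - 1) ≤ (Finset.Ioo (Finset.univ.filter fun i => z i ≤ m).card
        (Finset.univ.filter fun i => z i ≤ m').card).card := by
    intro z m m' hz
    have h1 : (Finset.univ.filter fun i => m < z i ∧ z i ≤ m').card ≤
        (Finset.univ.filter fun i => z i ≤ m').card -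
          (Finset.univ.filter fun i => z i ≤ m).card := by
      have hA : (Finset.univ.filter fun i => m < z i ∧ z i ≤ m') =
          (Finset.univ.filter fun i => z i ≤ m') \ (Finset.univ.filter fun i => z i ≤ m) := by
        ext i
        simp only [Finset.mem_sdiff, Finset.mem_filter, Finset.mem_univ, true_and, not_le]
        exact and_comm
      rcases le_or_gt m m' with hm | hm
      · rw [hA, Finset.card_sdiff_of_subset fun i hi => ?_]
        simp only [Finset.mem_filter, Finset.mem_univ, true_and] at hi ⊢
        exact hi.trans hm
      · rw [Finset.filter_false_of_mem fun i _ hi => (hm.trans hi.1).not_ge hi.2]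
        exact Nat.zero_le _
    have h2 : ((Finset.univ.filter fun i => m < z i ∧ z i ≤ m').card : ℝ) ≤
        (Finset.Ioo (Finset.univ.filter fun i => z i ≤ m).card
          (Finset.univ.filter fun i => z i ≤ m').card).card + 1 := by
      rw [Nat.card_Ioo]
      exact_mod_cast (by omega)
    nlinarith
  have hx' : ρ / 2 * (N - 1) ≤ (Finset.Ioo p p').card := hside x l l' <| h.box.trans <| by
    exact_mod_cast Finset.card_le_card fun i hi => by
      simp only [Finset.mem_filter, Finset.mem_univ, true_and] at hi ⊢
      exact hi.1
  have hy' : ρ / 2 * (N - 1) ≤ (Finset.Ioo q q').card := hside y k k' <| h.box.trans <| by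
    exact_mod_cast Finset.card_le_card fun i hi => by
      simp only [Finset.mem_filter, Finset.mem_univ, true_and] at hi ⊢
      exact hi.2
  have hIoo : ∀ (z : Fin N → ℝ) (m m' : ℝ), ∀ a ∈ Finset.Ioo
      (Finset.univ.filter fun i => z i ≤ m).card (Finset.univ.filter fun i => z i ≤ m').card,
      a ∈ Finset.Icc 1 (N - 1) := by
    intro z m m' a ha
    have h1 : (Finset.univ.filter fun i => z i ≤ m').card ≤ N :=
      (Finset.card_le_univ _).trans (by simp)
    rw [Finset.mem_Ioo] at ha
    rw [Finset.mem_Icc]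
    omega
  set G := (Finset.Ioo p p' ×ˢ Finset.Ioo q q').image
    fun ab : ℕ × ℕ => (({ab.1}, {ab.2}) : Finset ℕ × Finset ℕ) with hG
  have hGcard : (G.card : ℝ) = (Finset.Ioo p p').card * (Finset.Ioo q q').card := by
    rw [hG, Finset.card_image_of_injective, Finset.card_product, Nat.cast_mul]
    rintro ⟨a, b⟩ ⟨a', b'⟩ hab
    simpa using hab
  -- Each axis keeps a proportion ρ/2 of its cuts, so a proportion ρ²/4 of the pairs is good.
  refine sum_lt_sum_and_sSup_lt_sSup (G := G) (ρ := ρ ^ 2 / 4) (τ := δ ^ 2 / 4 * N)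
    ⟨({1}, {1}), mem_adpPartitions_two.2 ⟨1, Finset.mem_Icc.2 ⟨le_rfl, by omega⟩, 1,
      Finset.mem_Icc.2 ⟨le_rfl, by omega⟩, rfl⟩⟩ ?_ (by positivity) (by nlinarith) (by positivity)
    ?_ ?_ ?_ ?_
  · intro I hI
    obtain ⟨⟨a, b⟩, hab, rfl⟩ := Finset.mem_image.1 hI
    rw [Finset.mem_product] at hab
    exact mem_adpPartitions_two.2 ⟨a, hIoo x l l' a hab.1, b, hIoo y k k' b hab.2, rfl⟩
  · rw [card_adpPartitions_two, hGcard, Nat.cast_mul, Nat.cast_pred (by omega)]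
    have h1 : 0 ≤ ρ / 2 * ((N : ℝ) - 1) := by
      have : (0 : ℝ) ≤ N - 1 := by linarith
      positivity
    calc _ = (ρ / 2 * ((N : ℝ) - 1)) * (ρ / 2 * ((N : ℝ) - 1)) := by ring
      _ ≤ _ := mul_le_mul hx' hy' h1 (by positivity)
  · intro I hI
    obtain ⟨a, ha, b, hb, rfl⟩ := mem_adpPartitions_two.1 hI
    by_contra! hcon
    refine hπ (largeCorner_of_adpScore t π ha hb hc hc1 (hcon.trans' ?_))
    rw [← mul_assoc]
    gcongr
  · intro I hI
    obtain ⟨a, ha, b, hb, rfl⟩ := mem_adpPartitions_two.1 hI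
    exact adpScore_nonneg t (isRanking_rank hx) (isRanking_rank hy) ha hb
  · intro I hI
    obtain ⟨⟨a, b⟩, hab, rfl⟩ := Finset.mem_image.1 hI
    rw [Finset.mem_product] at hab
    exact h.le_adpScore t hx hy hN hδ hab.1 hab.2 (hIoo x l l' a hab.1) (hIoo y k k' b hab.2)

theorem GapBox.ddp_lt (h : GapBox x y l l' k k' δ ρ) (t : CellScore)
    (hx : Function.Injective x) (hy : Function.Injective y) (hN : 2 ≤ N) (hδ : 0 < δ)
    (hρ : 0 < ρ) (hρ1 : ρ ≤ 1) {c : ℝ} (hc : 0 < c) (hc1 : c ≤ 1)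
    (hcδ : 4 * c ^ 2 ≤ ρ ^ 2 / 4 * (δ ^ 2 / 4)) {π : Equiv.Perm (Fin N)}
    (hπ : ¬ LargeCorner (c ^ 2) π) :
    sumDDP t 2 natRank (fun i => natRank (π i)) < sumDDP t 2 (rank x) (rank y) ∧
      maxDDP t 2 natRank (fun i => natRank (π i)) < maxDDP t 2 (rank x) (rank y) := by
  have hN2 : (2 : ℝ) ≤ N := by exact_mod_cast hN
  set G := (Finset.univ.filter fun i => (l < x i ∧ x i ≤ l') ∧ (k < y i ∧ y i ≤ k')).image
    fun i => ({i} : Finset (Fin N)) with hG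
  have hGcard : (G.card : ℝ) =
      (Finset.univ.filter fun i => (l < x i ∧ x i ≤ l') ∧ (k < y i ∧ y i ≤ k')).card := by
    rw [hG, Finset.card_image_of_injective _ Finset.singleton_injective]
  refine sum_lt_sum_and_sSup_lt_sSup (G := G) (ρ := ρ) (τ := δ ^ 2 / 4 * N)
    ⟨{⟨0, by omega⟩}, mem_ddpPartitions_two.2 ⟨_, rfl⟩⟩ ?_ hρ hρ1 (by positivity)
    ?_ ?_ ?_ ?_
  · intro I hI
    obtain ⟨i, hi, rfl⟩ := Finset.mem_image.1 hI
    exact mem_ddpPartitions_two.2 ⟨i, rfl⟩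
  · rw [card_ddpPartitions_two, hGcard]
    exact h.box
  · intro I hI
    obtain ⟨i, rfl⟩ := mem_ddpPartitions_two.1 hI
    by_contra! hcon
    refine hπ (largeCorner_of_ddpScore t π hN hc hc1 (hcon.trans' ?_))
    rw [← mul_assoc]
    -- `c` is tuned to the smaller ADP proportion ρ²/4 and therefore also serves here.
    have : ρ ^ 2 / 4 ≤ ρ := by nlinarith
    have h2 : 4 * c ^ 2 ≤ ρ * (δ ^ 2 / 4) := hcδ.trans (by gcongr)
    gcongr
  · intro I hI
    obtain ⟨i, rfl⟩ := mem_ddpPartitions_two.1 hI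
    exact ddpScore_nonneg t (isRanking_rank hx) (isRanking_rank hy) hN
  · intro I hI
    obtain ⟨i, hi, rfl⟩ := Finset.mem_image.1 hI
    exact h.le_ddpScore t hx hy hN hδ (Finset.mem_filter.1 hi).2

theorem rejects_of_lt (T : ℕ → (Fin N → ℕ) → (Fin N → ℕ) → ℝ) (hN : 2 ≤ N) {M : ℕ} (hM : 2 ≤ M)
    {c α : ℝ} (hc : 0 < c) (hNc : 1088 ≤ c * √(√N))
    (hα : M * (16384 / c ^ 2 * (√N / (N - 1))) ≤ α)
    (hT : ∀ π : Equiv.Perm (Fin N), ¬ LargeCorner c π →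
      T 2 natRank (fun i => natRank (π i)) < T 2 (rank x) (rank y)) :
    Rejects T M α x y := by
  refine (minPTestPValue_le T hM _ _).trans (le_trans ?_ hα)
  gcongr
  refine pValue_le_of_imp (T 2) (B := LargeCorner c) (fun π hπ => ?_)
    (card_largeCorner_le hN hc hNc)
  by_contra hcon
  exact (hT π hcon).not_ge hπ

end Sample

end MinPTest

/-! ### Laws of large numbers for counts -/

section Counts

variable {Ω E : Type*} [MeasurableSpace Ω] {P : Measure Ω} [IsProbabilityMeasure P]
  [MeasurableSpace E] {Z : ℕ → Ω → E} {μ : Measure E}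

/-- The strong law of large numbers for the indicator of `p`. -/
theorem ae_tendsto_count (indep : iIndepFun Z P) (law : ∀ i, HasLaw (Z i) μ P) {p : E → Prop}
    [DecidablePred p] (hp : MeasurableSet {z | p z}) :
    ∀ᵐ ω ∂P, Tendsto (fun N : ℕ =>
      ((Finset.univ.filter fun i : Fin N => p (Z i ω)).card : ℝ) / N) atTop
        (𝓝 (μ.real {z | p z})) := by
  set φ : E → ℝ := {z | p z}.indicator 1 with hφ
  have hφm : Measurable φ := measurable_one.indicator hp
  have hid : ∀ i, IdentDistrib (fun ω => φ (Z i ω)) (fun ω => φ (Z 0 ω)) P P := fun i =>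
    IdentDistrib.comp ⟨(law i).aemeasurable, (law 0).aemeasurable,
      (law i).map_eq.trans (law 0).map_eq.symm⟩ hφm
  have hb : ∀ z, ‖φ z‖ ≤ 1 := fun z => by
    simp only [hφ, Set.indicator_apply]; split_ifs <;> simp
  have hint : Integrable (fun ω => φ (Z 0 ω)) P :=
    Integrable.of_bound (hφm.comp_aemeasurable (law 0).aemeasurable).aestronglyMeasurable 1
      (Eventually.of_forall fun ω => hb _)
  have h1 := strong_law_ae_real (fun i ω => φ (Z i ω)) hint
    (fun i j hij => (indep.indepFun hij).comp hφm hφm) hid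
  have h2 : ∫ ω, φ (Z 0 ω) ∂P = μ.real {z | p z} := by
    rw [← (law 0).map_eq, ← integral_indicator_one hp,
      integral_map (law 0).aemeasurable hφm.aestronglyMeasurable]
  rw [h2] at h1
  filter_upwards [h1] with ω hω
  convert hω using 2 with N
  congr 1
  rw [Finset.sum_range]
  simp [hφ, Set.indicator_apply]

/-- The diagonal is null for the product law because its slices are singletons; hence the sample has
no ties and its ranks form a ranking. -/
theorem ae_injective_of_nullSingleton [MeasurableEq E] [NullSingletonClass μ]
    (indep : ∀ i j, i ≠ j → Z i ⟂ᵢ[P] Z j) (law : ∀ i, HasLaw (Z i) μ P) : ∀ᵐ ω ∂P, Function.Injective fun i => Z i ω := by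
  have hμ : IsProbabilityMeasure μ := (law 0).map_eq ▸ Measure.isProbabilityMeasure_map
    (law 0).aemeasurable
  have h : ∀ i j, i ≠ j → ∀ᵐ ω ∂P, Z i ω ≠ Z j ω := by
    intro i j hij
    have h1 := (indepFun_iff_map_prod_eq_prod_map_map (law i).aemeasurable
      (law j).aemeasurable).1 (indep i j hij)
    rw [(law i).map_eq, (law j).map_eq] at h1
    have hd : MeasurableSet {p : E × E | p.1 ≠ p.2} := measurableSet_diagonal.compl
    have h2 : ∀ᵐ p ∂(μ.prod μ), p.1 ≠ p.2 := by
      rw [Measure.ae_prod_iff_ae_ae hd]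
      refine Eventually.of_forall fun x => ?_
      rw [ae_iff]
      simp
    rw [← h1] at h2
    exact ae_of_ae_map ((law i).aemeasurable.prodMk (law j).aemeasurable) h2
  have h' : ∀ᵐ ω ∂P, ∀ i j, i ≠ j → Z i ω ≠ Z j ω := by
    simp only [ae_all_iff]
    exact h
  filter_upwards [h'] with ω hω i j hij
  by_contra hne
  exact hω i j hne hij

end Counts

/-- The sets of ω lying in every `R n` with n ≥ N increase to a set of full measure. Continuity from
below needs no measurability of `R N`, so none has to be checked for the rejection events. -/
theorem tendsto_measure_of_ae_eventually {Ω : Type*} [MeasurableSpace Ω] {P : Measure Ω}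
    [IsProbabilityMeasure P] {R : ℕ → Set Ω}
    (h : ∀ᵐ ω ∂P, ∀ᶠ N in atTop, ω ∈ R N) : Tendsto (fun N => P (R N)) atTop (𝓝 1) := by
  have hmono : Monotone fun N => ⋂ n ≥ N, R n := fun N N' hN =>
    Set.biInter_subset_biInter_left fun n hn => le_trans hN hn
  have h1 := tendsto_measure_iUnion_atTop (μ := P) hmono
  have h2 : P (⋃ N, ⋂ n ≥ N, R n) = 1 := by
    rw [← measure_univ (μ := P)]
    refine measure_congr (eventuallyEq_univ.2 ?_)
    filter_upwards [h] with ω hω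
    obtain ⟨N, hN⟩ := eventually_atTop.1 hω
    exact Set.mem_iUnion.2 ⟨N, Set.mem_iInter₂.2 hN⟩
  rw [h2] at h1
  exact tendsto_of_tendsto_of_tendsto_of_le_of_le h1 tendsto_const_nhds
    (fun N => measure_mono (Set.biInter_subset_of_mem (le_refl N))) fun N => prob_le_one

/-! ### Almost sure rejection for all large sample sizes. -/

namespace MinPTest

section Sequence

/-- Limits of the corner frequencies turn into a box with a gap. -/
theorem eventually_gapBox {x y : ℕ → ℝ} {l l' k k' F F' G G' H H' B : ℝ} (hB : 0 < B)
    (hF : Tendsto (fun N : ℕ => ((Finset.univ.filter fun i : Fin N => x i ≤ l).card : ℝ) / N)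
      atTop (𝓝 F))
    (hF' : Tendsto (fun N : ℕ => ((Finset.univ.filter fun i : Fin N => x i ≤ l').card : ℝ) / N)
      atTop (𝓝 F'))
    (hG : Tendsto (fun N : ℕ => ((Finset.univ.filter fun i : Fin N => y i ≤ k).card : ℝ) / N)
      atTop (𝓝 G))
    (hG' : Tendsto (fun N : ℕ => ((Finset.univ.filter fun i : Fin N => y i ≤ k').card : ℝ) / N)
      atTop (𝓝 G'))
    (hH : Tendsto (fun N : ℕ =>
      ((Finset.univ.filter fun i : Fin N => x i ≤ l ∧ y i ≤ k).card : ℝ) / N) atTop (𝓝 H))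
    (hH' : Tendsto (fun N : ℕ =>
      ((Finset.univ.filter fun i : Fin N => x i ≤ l' ∧ y i ≤ k').card : ℝ) / N) atTop (𝓝 H'))
    (hbox : Tendsto (fun N : ℕ => ((Finset.univ.filter fun i : Fin N =>
      (l < x i ∧ x i ≤ l') ∧ (k < y i ∧ y i ≤ k')).card : ℝ) / N) atTop (𝓝 B))
    (hgap : F' * G' < H ∨ H' < F * G) :
    ∃ δ > 0, ∃ ρ > 0, ρ ≤ 1 ∧
      ∀ᶠ N : ℕ in atTop, GapBox (fun i : Fin N => x i) (fun i => y i) l l' k k' δ ρ := by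
  have hbox' : ∀ᶠ N : ℕ in atTop, min (B / 2) 1 * N ≤ (Finset.univ.filter fun i : Fin N =>
      (l < x i ∧ x i ≤ l') ∧ (k < y i ∧ y i ≤ k')).card := by
    filter_upwards [hbox.eventually_const_lt (show min (B / 2) 1 < B from
      (min_le_left _ _).trans_lt (by linarith)), eventually_gt_atTop 0] with N h1 h2
    have h2 : (0 : ℝ) < N := by exact_mod_cast h2
    exact ((lt_div_iff₀ h2).1 h1).le
  rcases hgap with hgap | hgap
  · refine ⟨(H - F' * G') / 2, by linarith, min (B / 2) 1, by positivity, min_le_right _ _, ?_⟩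
    have h := (hH.sub (hF'.mul hG')).eventually_const_lt
      (show (H - F' * G') / 2 < H - F' * G' by linarith)
    filter_upwards [hbox', h, eventually_gt_atTop 0] with N h1 h2 h3
    refine ⟨Or.inl ?_, h1⟩
    have h3 : (0 : ℝ) < N := by exact_mod_cast h3
    have h4 := mul_le_mul_of_nonneg_right h2.le h3.le
    have h5 : ∀ u v : ℝ, u / N * (v / N) * N = u * v / N := fun u v => by field_simp
    rw [sub_mul, h5, div_mul_cancel₀ _ h3.ne'] at h4
    linarith
  · refine ⟨(F * G - H') / 2, by linarith, min (B / 2) 1, by positivity, min_le_right _ _, ?_⟩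
    have h := ((hF.mul hG).sub hH').eventually_const_lt
      (show (F * G - H') / 2 < F * G - H' by linarith)
    filter_upwards [hbox', h, eventually_gt_atTop 0] with N h1 h2 h3
    refine ⟨Or.inr ?_, h1⟩
    have h3 : (0 : ℝ) < N := by exact_mod_cast h3
    have h4 := mul_le_mul_of_nonneg_right h2.le h3.le
    have h5 : ∀ u v : ℝ, u / N * (v / N) * N = u * v / N := fun u v => by field_simp
    rw [sub_mul, h5, div_mul_cancel₀ _ h3.ne'] at h4
    linarith

/-- For N ≥ 2 the factor √N/(N - 1) is at most 2/√N. -/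
theorem eventually_mul_bound_le {M : ℕ → ℕ}
    (hM : Tendsto (fun N : ℕ => (M N : ℝ) / √(N : ℝ)) atTop (𝓝 0)) (C : ℝ) {α : ℝ} (hα : 0 < α) :
    ∀ᶠ N : ℕ in atTop, (M N : ℝ) * (C * (√(N : ℝ) / (N - 1))) ≤ α := by
  have h1 : Tendsto (fun N : ℕ => (M N : ℝ) / √(N : ℝ) * (2 * |C|)) atTop (𝓝 0) := by
    simpa using hM.mul_const (2 * |C|)
  filter_upwards [h1.eventually_le_const hα, eventually_ge_atTop 2] with N h2 h3
  refine le_trans ?_ h2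
  have h3 : (2 : ℝ) ≤ N := by exact_mod_cast h3
  have h4 : √(N : ℝ) / (N - 1) ≤ 2 / √(N : ℝ) := by
    rw [div_le_div_iff₀ (by linarith) (by positivity), Real.mul_self_sqrt (by linarith)]
    linarith
  have h5 : 0 ≤ √(N : ℝ) / (N - 1) := div_nonneg (by positivity) (by linarith)
  calc (M N : ℝ) * (C * (√(N : ℝ) / (N - 1))) ≤ M N * (|C| * (2 / √(N : ℝ))) := by
        gcongr
        exact le_abs_self C
    _ = _ := by ring

/-- Samples with a visible local dependence are rejected by all four tests. -/
theorem eventually_rejects {x y : ℕ → ℝ} (hx : Function.Injective x) (hy : Function.Injective y)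
    {l l' k k' δ ρ : ℝ} (hδ : 0 < δ) (hρ : 0 < ρ) (hρ1 : ρ ≤ 1)
    (hbox : ∀ᶠ N : ℕ in atTop, GapBox (fun i : Fin N => x i) (fun i => y i) l l' k k' δ ρ)
    {M : ℕ → ℕ} (hM2 : ∀ᶠ N in atTop, 2 ≤ M N)
    (hM : Tendsto (fun N : ℕ => (M N : ℝ) / √(N : ℝ)) atTop (𝓝 0))
    (t : CellScore) {α : ℝ} (hα : 0 < α) :
    ∀ᶠ N : ℕ in atTop,
      (Rejects (N := N) (fun m => sumDDP t m) (M N) α (fun i => x i) (fun i => y i) ∧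
        Rejects (N := N) (fun m => sumADP t m) (M N) α (fun i => x i) (fun i => y i)) ∧
      (Rejects (N := N) (fun m => maxDDP t m) (M N) α (fun i => x i) (fun i => y i) ∧
        Rejects (N := N) (fun m => maxADP t m) (M N) α (fun i => x i) (fun i => y i)) := by
  -- `c ≤ 1` is required by `exists_large_dev`, and ρδ/8 solves 4c² = (ρ²/4)(δ²/4). The corners have
  -- excess constant `c ^ 2`, whence the fourth power of `c` in the bound below.
  set c : ℝ := min 1 (ρ * δ / 8) with hc
  have hc0 : 0 < c := by positivity
  have hcδ : 4 * c ^ 2 ≤ ρ ^ 2 / 4 * (δ ^ 2 / 4) := by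
    calc 4 * c ^ 2 ≤ 4 * (ρ * δ / 8) ^ 2 := by gcongr; exact min_le_right _ _
      _ = _ := by ring
  have hbig : ∀ᶠ N : ℕ in atTop, 1088 ≤ c ^ 2 * √(√(N : ℝ)) :=
    ((Real.tendsto_sqrt_atTop.comp (Real.tendsto_sqrt_atTop.comp
      tendsto_natCast_atTop_atTop)).const_mul_atTop (by positivity)).eventually_ge_atTop 1088
  have hρN : ∀ᶠ N : ℕ in atTop, 2 ≤ ρ * N :=
    (tendsto_natCast_atTop_atTop.const_mul_atTop hρ).eventually_ge_atTop 2
  filter_upwards [hbox, hM2, hbig, hρN, eventually_ge_atTop 2,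
    eventually_mul_bound_le hM (16384 / (c ^ 2) ^ 2) hα] with N h1 h2 h3 h4 h5 h6
  have hx' : Function.Injective fun i : Fin N => x i := hx.comp Fin.val_injective
  have hy' : Function.Injective fun i : Fin N => y i := hy.comp Fin.val_injective
  have hadp := fun π hπ => h1.adp_lt t hx' hy' h5 hδ hρ hρ1 h4 hc0 (min_le_left _ _) hcδ (π := π) hπ
  have hddp := fun π hπ => h1.ddp_lt t hx' hy' h5 hδ hρ hρ1 hc0 (min_le_left _ _) hcδ (π := π) hπ
  refine ⟨⟨?_, ?_⟩, ?_, ?_⟩ <;>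
    refine rejects_of_lt _ h5 h2 (by positivity) h3 h6 fun π hπ => ?_
  · exact (hddp π hπ).1
  · exact (hadp π hπ).1
  · exact (hddp π hπ).2
  · exact (hadp π hπ).2

theorem tendsto_div_sqrt_of_bounded {M : ℕ → ℕ} {C : ℕ} (h : ∀ N, M N ≤ C) :
    Tendsto (fun N : ℕ => (M N : ℝ) / √(N : ℝ)) atTop (𝓝 0) := by
  have h1 : Tendsto (fun N : ℕ => (C : ℝ) / √(N : ℝ)) atTop (𝓝 0) :=
    tendsto_const_nhds.div_atTop (Real.tendsto_sqrt_atTop.comp tendsto_natCast_atTop_atTop)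
  refine squeeze_zero (fun N => by positivity) (fun N => ?_) h1
  gcongr
  exact h N

theorem tendsto_div_sqrt_of_cubeRoot {M : ℕ → ℕ}
    (h : Tendsto (fun N : ℕ => (M N : ℝ) / (N : ℝ) ^ ((1 : ℝ) / 3)) atTop (𝓝 0)) :
    Tendsto (fun N : ℕ => (M N : ℝ) / √(N : ℝ)) atTop (𝓝 0) := by
  refine squeeze_zero' (Eventually.of_forall fun N => by positivity) ?_ h
  filter_upwards [eventually_ge_atTop 1] with N hN
  have hN : (1 : ℝ) ≤ N := by exact_mod_cast hN
  rw [Real.sqrt_eq_rpow]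
  refine div_le_div_of_nonneg_left (by positivity) (by positivity) ?_
  exact Real.rpow_le_rpow_of_exponent_le hN (by norm_num)

end Sequence

end MinPTest

/-! ### Consistency of the four tests. -/

theorem theorem6 {Ω : Type*} [MeasurableSpace Ω] (P : Measure Ω) [IsProbabilityMeasure P]
    (X Y : ℕ → Ω → ℝ) (h : ℝ × ℝ → ℝ) (f g : ℝ → ℝ)
    (h_meas : Measurable h) (f_meas : Measurable f) (g_meas : Measurable g)
    (h_nonneg : ∀ z, 0 ≤ h z) (f_nonneg : ∀ x, 0 ≤ f x) (g_nonneg : ∀ y, 0 ≤ g y)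
    -- independent observations with joint density `h` and marginal densities `f` and `g`
    (indep : iIndepFun (fun i ω => (X i ω, Y i ω)) P)
    (law_XY : ∀ i, HasLaw (fun ω => (X i ω, Y i ω))
      (volume.withDensity fun z => ENNReal.ofReal (h z)) P)
    (law_X : ∀ i, HasLaw (X i) (volume.withDensity fun x => ENNReal.ofReal (f x)) P)
    (law_Y : ∀ i, HasLaw (Y i) (volume.withDensity fun y => ENNReal.ofReal (g y)) P)
    -- local dependence at a continuous density point
    (x₀ y₀ : ℝ) (h_cont : ContinuousAt h (x₀, y₀))
    (f_cont : ContinuousAt f x₀) (g_cont : ContinuousAt g y₀)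
    (dep : h (x₀, y₀) ≠ f x₀ * g y₀)
    -- the largest partition size, as a function of the sample size, and the cell score
    (mmax : ℕ → ℕ) (two_le_mmax : ∀ᶠ N in atTop, 2 ≤ mmax N) (t : MinPTest.CellScore) :
    (((∃ C : ℕ, ∀ N, mmax N ≤ C) ∨
        Tendsto (fun N : ℕ => (mmax N : ℝ) / (N : ℝ) ^ ((1 : ℝ) / 3)) atTop (𝓝 0)) →
      MinPTest.Consistent P X Y (MinPTest.sumDDP t) mmax ∧
      MinPTest.Consistent P X Y (MinPTest.sumADP t) mmax) ∧
    (((∃ C : ℕ, ∀ N, mmax N ≤ C) ∨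
        Tendsto (fun N : ℕ => (mmax N : ℝ) / Real.sqrt (N : ℝ)) atTop (𝓝 0)) →
      MinPTest.Consistent P X Y (MinPTest.maxDDP t) mmax ∧
      MinPTest.Consistent P X Y (MinPTest.maxADP t) mmax) := by
  have hμ : IsProbabilityMeasure (volume.withDensity fun z => ENNReal.ofReal (h z)) :=
    (law_XY 0).map_eq ▸ Measure.isProbabilityMeasure_map (law_XY 0).aemeasurable
  have hμX : IsProbabilityMeasure (volume.withDensity fun x => ENNReal.ofReal (f x)) :=
    (law_X 0).map_eq ▸ Measure.isProbabilityMeasure_map (law_X 0).aemeasurable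
  have hμY : IsProbabilityMeasure (volume.withDensity fun y => ENNReal.ofReal (g y)) :=
    (law_Y 0).map_eq ▸ Measure.isProbabilityMeasure_map (law_Y 0).aemeasurable
  obtain ⟨z, hz, hpos⟩ := exists_cdfGap_ne_zero h_meas f_meas g_meas h_nonneg f_nonneg g_nonneg
    h_cont f_cont g_cont dep
  have hF : Continuous fun x =>
      (volume.withDensity fun x => ENNReal.ofReal (f x)).real (Set.Iic x) := by
    simp_rw [withDensity_ofReal_real f_meas f_nonneg measurableSet_Iic]
    exact continuous_integral_Iic (integrable_of_isProbabilityMeasure_withDensity f_meas f_nonneg)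
  have hG : Continuous fun y =>
      (volume.withDensity fun y => ENNReal.ofReal (g y)).real (Set.Iic y) := by
    simp_rw [withDensity_ofReal_real g_meas g_nonneg measurableSet_Iic]
    exact continuous_integral_Iic (integrable_of_isProbabilityMeasure_withDensity g_meas g_nonneg)
  have hfst : (volume.withDensity fun z => ENNReal.ofReal (h z)).map Prod.fst =
      volume.withDensity fun x => ENNReal.ofReal (f x) := by
    rw [← (law_XY 0).map_eq, ← (law_X 0).map_eq,
      AEMeasurable.map_map_of_aemeasurable measurable_fst.aemeasurable (law_XY 0).aemeasurable]
    rfl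
  have hsnd : (volume.withDensity fun z => ENNReal.ofReal (h z)).map Prod.snd =
      volume.withDensity fun y => ENNReal.ofReal (g y) := by
    rw [← (law_XY 0).map_eq, ← (law_Y 0).map_eq,
      AEMeasurable.map_map_of_aemeasurable measurable_snd.aemeasurable (law_XY 0).aemeasurable]
    rfl
  obtain ⟨l, l', k, k', hB, hgap⟩ := exists_box_of_cdfGap_ne_zero hfst hsnd hF hG hz hpos
  have indep_X : ∀ i j, i ≠ j → X i ⟂ᵢ[P] X j := fun i j hij =>
    (indep.indepFun hij).comp measurable_fst measurable_fst
  have indep_Y : ∀ i j, i ≠ j → Y i ⟂ᵢ[P] Y j := fun i j hij =>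
    (indep.indepFun hij).comp measurable_snd measurable_snd
  have hIX : ∀ c, (volume.withDensity fun x => ENNReal.ofReal (f x)).real (Set.Iic c) =
      (volume.withDensity fun z => ENNReal.ofReal (h z)).real {z | z.1 ≤ c} := fun c => by
    rw [← hfst, map_measureReal_apply measurable_fst measurableSet_Iic]
    rfl
  have hIY : ∀ c, (volume.withDensity fun y => ENNReal.ofReal (g y)).real (Set.Iic c) =
      (volume.withDensity fun z => ENNReal.ofReal (h z)).real {z | z.2 ≤ c} := fun c => by
    rw [← hsnd, map_measureReal_apply measurable_snd measurableSet_Iic]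
    rfl
  rw [hIX, hIX, hIY, hIY] at hgap
  have hX (c : ℝ) : MeasurableSet {z : ℝ × ℝ | z.1 ≤ c} := measurable_fst measurableSet_Iic
  have hY (c : ℝ) : MeasurableSet {z : ℝ × ℝ | z.2 ≤ c} := measurable_snd measurableSet_Iic
  have hXY (c d : ℝ) : MeasurableSet {z : ℝ × ℝ | z.1 ≤ c ∧ z.2 ≤ d} :=
    measurableSet_Iic.prod measurableSet_Iic
  have hbox : MeasurableSet {z : ℝ × ℝ | (l < z.1 ∧ z.1 ≤ l') ∧ (k < z.2 ∧ z.2 ≤ k')} :=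
    measurableSet_Ioc.prod measurableSet_Ioc
  have hae : Tendsto (fun N : ℕ => (mmax N : ℝ) / √(N : ℝ)) atTop (𝓝 0) →
      ∀ α : ℝ, 0 < α → ∀ᵐ ω ∂P, ∀ᶠ N : ℕ in atTop,
      (MinPTest.Rejects (N := N) (fun m => MinPTest.sumDDP t m) (mmax N) α
          (fun i => X i ω) (fun i => Y i ω) ∧
        MinPTest.Rejects (N := N) (fun m => MinPTest.sumADP t m) (mmax N) α
          (fun i => X i ω) (fun i => Y i ω)) ∧
      (MinPTest.Rejects (N := N) (fun m => MinPTest.maxDDP t m) (mmax N) α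
          (fun i => X i ω) (fun i => Y i ω) ∧
        MinPTest.Rejects (N := N) (fun m => MinPTest.maxADP t m) (mmax N) α
          (fun i => X i ω) (fun i => Y i ω)) := by
    intro hM α hα
    -- Only seven frequencies enter: the marginal ones at the four sides of the box, the joint ones
    -- at two opposite corners, and that of the box itself.
    filter_upwards [ae_injective_of_nullSingleton indep_X law_X, ae_injective_of_nullSingleton indep_Y law_Y,
      ae_tendsto_count indep law_XY (hX l), ae_tendsto_count indep law_XY (hX l'),
      ae_tendsto_count indep law_XY (hY k), ae_tendsto_count indep law_XY (hY k'),
      ae_tendsto_count indep law_XY (hXY l k), ae_tendsto_count indep law_XY (hXY l' k'),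
      ae_tendsto_count indep law_XY hbox] with ω hx hy h1 h2 h3 h4 h5 h6 h7
    obtain ⟨δ, hδ, ρ, hρ, hρ1, hev⟩ := MinPTest.eventually_gapBox (x := fun i => X i ω)
      (y := fun i => Y i ω) hB h1 h2 h3 h4 h5 h6 h7 hgap
    exact MinPTest.eventually_rejects hx hy hδ hρ hρ1 hev two_le_mmax hM t hα
  constructor
  · intro hm
    have hM : Tendsto (fun N : ℕ => (mmax N : ℝ) / √(N : ℝ)) atTop (𝓝 0) := by
      rcases hm with ⟨C, hC⟩ | hm
      · exact MinPTest.tendsto_div_sqrt_of_bounded hC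
      · exact MinPTest.tendsto_div_sqrt_of_cubeRoot hm
    exact ⟨fun α hα _ => tendsto_measure_of_ae_eventually <|
        (hae hM α hα).mono fun ω hω => hω.mono fun N hN => hN.1.1,
      fun α hα _ => tendsto_measure_of_ae_eventually <|
        (hae hM α hα).mono fun ω hω => hω.mono fun N hN => hN.1.2⟩
  · intro hm
    have hM : Tendsto (fun N : ℕ => (mmax N : ℝ) / √(N : ℝ)) atTop (𝓝 0) := by
      rcases hm with ⟨C, hC⟩ | hm
      · exact MinPTest.tendsto_div_sqrt_of_bounded hC
      · exact hm
    exact ⟨fun α hα _ => tendsto_measure_of_ae_eventually <|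
        (hae hM α hα).mono fun ω hω => hω.mono fun N hN => hN.2.1,
      fun α hα _ => tendsto_measure_of_ae_eventually <|
        (hae hM α hα).mono fun ω hω => hω.mono fun N hN => hN.2.2⟩
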